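/- Let $m\ge 1$, let $\mathcal M$ be the set of $m\times m$ row-stochastic matrices and $\Delta_m$ the set of probability vectors on $[m]=\{1,\dots,m\}$. For $P\in\mathcal M$ and $\mu\in\Delta_m$ let $\mathbb P_{P,\mu}$ be the law of the Markov chain $X_0,X_1,\dots$ on $[m]$ with transition matrix $P$ and initial distribution $\mu$. Let $\mathcal P,\mathcal Q\subseteq\mathcal M$ and $\alpha\in(0,1)$. An $\alpha$-correct, power-one sequential test of $\mathcal P$ against $\mathcal Q$ is a stopping time $\tau_\alpha\in\{0,1,\dots\}\cup\{\infty\}$ of the natural filtration of $(X_n)_{n\ge0}$ such that, for all $\mu\in\Delta_m$, $\mathbb P_{P,\mu}(\tau_\alpha<\infty)\le\alpha$ for every $P\in\mathcal P$ and $\mathbb P_{Q,\mu}(\tau_\alpha<\infty)=1$ for every $Q\in\mathcal Q$. Write $Q\ll P$ if $P(i,j)=0$ implies $Q(i,j)=0$. For an ergodic (irreducible and aperiodic) $Q$ with stationary distribution $\pi$, and $Q\ll P$, put $$f_P(i)=\sum_{j}Q(i,j)\log\frac{Q(i,j)}{P(i,j)},\qquad D_{\mathcal M}(Q,P)=\sum_i\pi_i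 f_P(i),$$ and put $D_{\mathcal M}(Q,P)=\infty$ if $Q\not\ll P$. Let $D^{\inf}_{\mathcal M}(Q,\mathcal P)=\inf_{P\in\mathcal P}D_{\mathcal M}(Q,P)\in[0,\infty]$ (with $\inf\varnothing=\infty$), let $\pi_*=\min_i\pi_i$, and for $f\in\mathbb R^m$ let $\omega_{Q,f}=\sum_{n\ge0}(Q^n-\mathbf 1\pi)f$, which solves the Poisson equation $(I-Q)\omega=f-(\pi f)\mathbf 1$. Let $Q^*(i,j)=Q(j,i)\pi_j/\pi_i$ and let $$\gamma_{\rm ps}=\max_{k\ge1}\frac{1-\lambda_2\big((Q^*)^kQ^k\big)}{k}\in(0,1]$$ be the pseudo-spectral gap, where $\lambda_2$ is the second largest eigenvalue, counted with multiplicity (and $\lambda_2=0$ if $m=1$). Put $$C_Q=\frac{(1-\gamma_{\rm ps})^{-1/(2\gamma_{\rm ps})}}{\sqrt{\pi_*}}\cdot\frac1{1-\sqrt{1-\gamma_{\rm ps}}}\ \text{ if }\gamma_{\rm ps}<1,\qquad C_Q=2\ \text{ if }\gamma_{\rm ps}=1.$$ **Theorem.** Let $Q\in\mathcal Q$ be ergodic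 with stationary distribution $\pi$, let $\tau_\alpha$ be the stopping time of any $\alpha$-correct, power-one sequential test of $\mathcal P$ against $\mathcal Q$, and let $\mu\in\Delta_m$ be any initial distribution; write $\mathbb E_Q$ for the expectation under $\mathbb P_{Q,\mu}$. Then for every $P\in\mathcal P$ with $Q\ll P$ one has $D_{\mathcal M}(Q,P)>0$ and $$\mathbb E_Q[\tau_\alpha]\ \ge\ \frac{\log(1/\alpha)}{D_{\mathcal M}(Q,P)}-\frac{\mathbb E_Q\big[\omega_{Q,f_P}(X_0)-\omega_{Q,f_P}(X_{\tau_\alpha})\big]}{D_{\mathcal M}(Q,P)}.$$ Moreover, $$\mathbb E_Q[\tau_\alpha]\ \ge\ \left(\frac{\log(1/\alpha)}{D^{\inf}_{\mathcal M}(Q,\mathcal P)}-\frac{2C_Q}{\pi_*}\right)^+,$$ where $\log(1/\alpha)/\infty=0$ and $\log(1/\alpha)/0=\infty$, and $\mathbb E_Q[\tau_\alpha]\in[0,\infty]$. -/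

import Mathlib

open MeasureTheory ProbabilityTheory
open scoped ENNReal BigOperators

namespace MarkovTest

noncomputable section

/-- Transition matrices on the state space `[m]`: nonnegative matrices whose rows sum to one. -/
abbrev TransitionMatrix (m : ℕ) : Type := Matrix.rowStochastic ℝ (Fin m)

/-- Probability vectors on `[m]`. -/
abbrev ProbVec (m : ℕ) : Type := stdSimplex ℝ (Fin m)

/-- The `i`-th row of a transition matrix, as a probability vector. -/
def row {m : ℕ} (P : TransitionMatrix m) (i : Fin m) : ProbVec m :=
  ⟨fun j => P.1 i j, fun j => P.2.1 i j, Matrix.sum_row_of_mem_rowStochastic P.2 i⟩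

/-! ### The law of a Markov chain on path space -/

/-- The measure on `[m]` with mass function `p`. -/
def toMeasure {m : ℕ} (p : ProbVec m) : Measure (Fin m) :=
  ∑ i, ENNReal.ofReal (p i) • Measure.dirac i

instance {m : ℕ} (p : ProbVec m) : IsProbabilityMeasure (toMeasure p) := by
  constructor
  have h : ∑ i, ENNReal.ofReal (p i) = 1 := by
    have h1 : ∑ i, p i = 1 := p.2.2
    have h2 : ∀ i ∈ Finset.univ, 0 ≤ p i := fun i _ => p.2.1 i
    rw [← ENNReal.ofReal_sum_of_nonneg h2, h1, ENNReal.ofReal_one]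
  simpa [toMeasure] using h

/-- The Markov kernel that, given the past `x 0, …, x n`, draws the next state from the row
`P (x n, ·)`. -/
def stepKernel {m : ℕ} (P : TransitionMatrix m) (n : ℕ) :
    Kernel ((i : Finset.Iic n) → (fun _ : ℕ => Fin m) i) (Fin m) :=
  Kernel.ofFunOfCountable fun x => toMeasure (row P (x ⟨n, Finset.mem_Iic.2 le_rfl⟩))

instance {m : ℕ} (P : TransitionMatrix m) (n : ℕ) : IsMarkovKernel (stepKernel P n) :=
  ⟨fun x => by
    change IsProbabilityMeasure (toMeasure (row P (x ⟨n, Finset.mem_Iic.2 le_rfl⟩)))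
    infer_instance⟩

/-- The law on path space `[m]^ℕ` of the Markov chain `X 0, X 1, …` with transition matrix `P`
and initial distribution `μ`. -/
def chainLaw {m : ℕ} (P : TransitionMatrix m) (μ : ProbVec m) : Measure (ℕ → Fin m) :=
  Kernel.trajMeasure (X := fun _ => Fin m) (toMeasure μ) (stepKernel P)

/-- The defining formula of the chain:
`Prob (X 0 = a 0, …, X n = a n) = μ (a 0) * ∏ t < n, P (a t, a (t + 1))`. -/
theorem chainLaw_cylinder {m : ℕ} (P : TransitionMatrix m) (μ : ProbVec m) (a : ℕ → Fin m)
    (n : ℕ) :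
    chainLaw P μ {x | ∀ i ≤ n, x i = a i} =
      ENNReal.ofReal (μ (a 0)) * ∏ t ∈ Finset.range n, ENNReal.ofReal (P.1 (a t) (a (t + 1))) := by
  have hmeas : ∀ (p : ProbVec m) (i : Fin m), toMeasure p {i} = ENNReal.ofReal (p i) := by
    intro p i
    simp [toMeasure, Measure.finsetSum_apply, Set.indicator_apply, Finset.sum_ite_eq']
  induction n with
  | zero =>
    have h0 : (chainLaw P μ).map (fun x => x 0) = toMeasure μ := by
      have h1 : (chainLaw P μ).map (Preorder.frestrictLe (π := fun _ => Fin m) 0) =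
          (toMeasure μ).map (MeasurableEquiv.piUnique
            (fun i : Finset.Iic 0 => (fun _ : ℕ => Fin m) i)).symm := by
        rw [chainLaw, Kernel.trajMeasure, Measure.map_comp _ _ (by fun_prop),
          Kernel.traj_map_frestrictLe, Kernel.partialTraj_self, Measure.id_comp]
      have h2 := congrArg
        (Measure.map (fun y : (i : Finset.Iic 0) → Fin m => y ⟨0, by simp⟩)) h1
      rw [Measure.map_map (by fun_prop) (by fun_prop),
        Measure.map_map (by fun_prop) (by fun_prop)] at h2
      exact h2.trans Measure.map_id
    have hs : {x : ℕ → Fin m | ∀ i ≤ 0, x i = a i} = (fun x => x 0) ⁻¹' {a 0} := by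
      ext x; simp
    rw [hs, ← Measure.map_apply (by fun_prop) (MeasurableSet.singleton _), h0, hmeas]
    simp
  | succ n ih =>
    have key := Kernel.map_frestrictLe_trajMeasure_compProd_eq_map_trajMeasure
      (X := fun _ => Fin m) (μ₀ := toMeasure μ) (κ := stepKernel P) (a := n)
    let b : (i : Finset.Iic n) → (fun _ : ℕ => Fin m) i := fun i => a i
    have hs : {x : ℕ → Fin m | ∀ i ≤ n + 1, x i = a i} =
        (fun x => (Preorder.frestrictLe (π := fun _ => Fin m) n x, x (n + 1))) ⁻¹' ({b} ×ˢ {a (n + 1)}) := by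
      ext x
      simp only [Set.mem_ofPred_eq, Set.mem_preimage, Set.mem_prod, Set.mem_singleton_iff,
        funext_iff, Preorder.frestrictLe_apply, b]
      constructor
      · exact fun h => ⟨fun i => h _ (by have := Finset.mem_Iic.1 i.2; omega), h _ le_rfl⟩
      · rintro ⟨h1, h2⟩ i hi
        rcases Nat.lt_or_ge n i with h | h
        · obtain rfl : i = n + 1 := by omega
          exact h2
        · exact h1 ⟨i, Finset.mem_Iic.2 h⟩
    have hs' : {x : ℕ → Fin m | ∀ i ≤ n, x i = a i} = (Preorder.frestrictLe (π := fun _ => Fin m) n) ⁻¹' {b} := by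
      ext x
      simp only [Set.mem_ofPred_eq, Set.mem_preimage, Set.mem_singleton_iff,
        funext_iff, Preorder.frestrictLe_apply, b]
      exact ⟨fun h i => h _ (Finset.mem_Iic.1 i.2), fun h i hi => h ⟨i, Finset.mem_Iic.2 hi⟩⟩
    rw [Finset.prod_range_succ, ← mul_assoc, ← ih, hs, hs']
    change Kernel.trajMeasure (X := fun _ => Fin m) (toMeasure μ) (stepKernel P) _ =
      Kernel.trajMeasure (X := fun _ => Fin m) (toMeasure μ) (stepKernel P) _ * _
    rw [← Measure.map_apply (by fun_prop) (MeasurableSet.singleton _),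
      ← Measure.map_apply (by fun_prop)
        ((MeasurableSet.singleton _).prod (MeasurableSet.singleton _)), ← key,
      Measure.compProd_apply_prod (MeasurableSet.singleton _) (MeasurableSet.singleton _),
      lintegral_singleton]
    rw [mul_comm]
    congr 1
    exact hmeas (row P (a n)) (a (n + 1))

/-! ### Ergodicity and the Poisson equation -/

/-- Ergodic: irreducible and aperiodic. Aperiodicity says that for every state `i` the greatest
common divisor of the return times `{n ≥ 1 | P ^ n (i, i) > 0}` equals one. -/
def IsErgodic {m : ℕ} (P : TransitionMatrix m) : Prop :=
  P.1.IsIrreducible ∧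
    ∀ i : Fin m, ∀ d : ℕ, (∀ n : ℕ, 1 ≤ n → 0 < (P.1 ^ n) i i → d ∣ n) → d = 1

/-- `π` is a stationary distribution of `P`: `π P = π`. -/
def IsStationary {m : ℕ} (P : TransitionMatrix m) (π : ProbVec m) : Prop :=
  Matrix.vecMul (fun i => π i) P.1 = fun i => π i

/-- The solution `ω = ∑ n ≥ 0, (P ^ n - 1 π) f` of the Poisson equation
`(I - P) ω = f - (π f) 1`. -/
def poissonSol {m : ℕ} (P : TransitionMatrix m) (π : ProbVec m) (f : Fin m → ℝ) : Fin m → ℝ :=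
  ∑' n : ℕ, Matrix.mulVec (P.1 ^ n - Matrix.of fun _ j => π j) f

/-! ### The pseudo-spectral gap and the constant of the lower bound -/

/-- Time reversal `P* (i, j) = P (j, i) π j / π i`. -/
def timeReversal {m : ℕ} (P : TransitionMatrix m) (π : ProbVec m) :
    Matrix (Fin m) (Fin m) ℝ :=
  Matrix.of fun i j => P.1 j i * π j / π i

/-- The spectral gap `1 - lam₂` of a matrix whose eigenvalues, listed with multiplicity, are
`lam₁ ≥ lam₂ ≥ … ≥ lamₘ` (used for reversible transition matrices, all of whose eigenvalues are
real). On a one-point state space, where there is no second eigenvalue, `lam₂ = 0` is used. -/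
def spectralGap {m : ℕ} (R : Matrix (Fin m) (Fin m) ℝ) : ℝ :=
  1 - (R.charpoly.roots.sort (· ≥ ·)).getD 1 0

/-- The pseudo-spectral gap: the maximum over `k ≥ 1` of the spectral gap of `(P*) ^ k P ^ k`
divided by `k`. -/
def pseudoGap {m : ℕ} (P : TransitionMatrix m) (π : ProbVec m) : ℝ :=
  ⨆ k : ℕ+, spectralGap (timeReversal P π ^ (k : ℕ) * P.1 ^ (k : ℕ)) / (k : ℕ)

/-- The smallest stationary weight `min i, π i`. -/
def minWeight {m : ℕ} (π : ProbVec m) : ℝ := ⨅ i, π i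

/-- The constant `C_P`, where `g` is the pseudo-spectral gap of `P`:
`(1 - g) ^ (-1 / (2 g)) / √(min π) * (1 / (1 - √(1 - g)))` if `g < 1`, and `2` if `g = 1`. -/
def poissonConst {m : ℕ} (P : TransitionMatrix m) (π : ProbVec m) : ℝ :=
  if pseudoGap P π = 1 then 2
  else
    (1 - pseudoGap P π) ^ (-(1 / (2 * pseudoGap P π))) / √(minWeight π) *
      (1 / (1 - √(1 - pseudoGap P π)))

/-! ### Divergences -/

/-- Row-wise absolute continuity `Q ≪ P`. -/
def RowAC {m : ℕ} (Q P : TransitionMatrix m) : Prop :=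
  ∀ i j, P.1 i j = 0 → Q.1 i j = 0

/-- The Kullback-Leibler divergence `∑ j, q j log (q j / p j)` (for `q ≪ p`; terms with
`q j = 0` vanish). -/
def kl {m : ℕ} (q p : ProbVec m) : ℝ := ∑ j, q j * Real.log (q j / p j)

/-- The vector `f_P (i) = KL (Q (i, ·), P (i, ·))` (for `Q ≪ P`). -/
def rowKL {m : ℕ} (Q P : TransitionMatrix m) : Fin m → ℝ := fun i => kl (row Q i) (row P i)

/-- The stationary-weighted divergence `D(Q, P) = ∑ i, π i KL (Q (i, ·), P (i, ·))` (for
`Q ≪ P`), where `π` is the stationary distribution of `Q`. -/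
def statKL {m : ℕ} (π : ProbVec m) (Q P : TransitionMatrix m) : ℝ :=
  ∑ i, π i * rowKL Q P i

/-- The infimum of `D(Q, P)` over `P ∈ H0`, with `D(Q, P) = ∞` unless `Q ≪ P`; in particular it is
`∞` if `Q ≪ P` holds for no `P ∈ H0`. -/
def statKLInf {m : ℕ} (π : ProbVec m) (Q : TransitionMatrix m) (H0 : Set (TransitionMatrix m)) :
    ℝ≥0∞ :=
  ⨅ P ∈ H0, ⨅ _ : RowAC Q P, ENNReal.ofReal (statKL π Q P)

/-! ### Sequential tests -/

/-- `τ` is the stopping time of an `α`-correct, power-one sequential test of `H0` against `H1`: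
a stopping time of the natural filtration of the observations `X 0, X 1, …` (the coordinates on
path space) such that, for all initial distributions, it is finite with probability at most `α`
under each `P ∈ H0` and with probability one under each `Q ∈ H1`. -/
structure IsTest {m : ℕ} (H0 H1 : Set (TransitionMatrix m)) (α : ℝ)
    (τ : (ℕ → Fin m) → ℕ∞) : Prop where
  isStoppingTime : IsStoppingTime (Filtration.piLE (X := fun _ : ℕ => Fin m)) τ
  alphaCorrect : ∀ P ∈ H0, ∀ μ : ProbVec m, chainLaw P μ {x | τ x < ⊤} ≤ ENNReal.ofReal α
  powerOne : ∀ Q ∈ H1, ∀ μ : ProbVec m, chainLaw Q μ {x | τ x < ⊤} = 1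

/-- The expected stopping time `E[τ] ∈ [0, ∞]` under the chain `(Q, μ)`. -/
def expectedTime {m : ℕ} (Q : TransitionMatrix m) (μ : ProbVec m) (τ : (ℕ → Fin m) → ℕ∞) :
    ℝ≥0∞ :=
  ∫⁻ x, (τ x : ℝ≥0∞) ∂(chainLaw Q μ)

/-- The correction `E[ω (X 0) - ω (X τ)]` under the chain `(Q, μ)`. -/
def poissonCorrection {m : ℕ} (Q : TransitionMatrix m) (μ : ProbVec m)
    (τ : (ℕ → Fin m) → ℕ∞) (ω : Fin m → ℝ) : ℝ :=
  ∫ x, (ω (x 0) - ω (stoppedValue (fun (n : ℕ) (y : ℕ → Fin m) => y n) τ x)) ∂(chainLaw Q μ)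

end

end MarkovTest

namespace MarkovTest

noncomputable section

open Matrix

/-! ### Positivity of powers -/

/-! Let `L n` be the log-likelihood ratio of Q against P over n transitions. If Q ≪ P, then exp(-L
n) dQ ≤ dP on events of the first n transitions. Summing over the events τ = n and using that τ is
a.s. finite under Q gives E_Q[exp(-L τ)] ≤ α, and Jensen's inequality gives log(1/α) ≤ E_Q[L τ]. The
chain's log-likelihood increments are not independent, and the Poisson equation removes the
dependence: with ω - Qω = f_P - D, the process L n - nD - ω(X 0) + ω(X n) is a martingale with
bounded increments. When E_Q[τ] is finite, optional stopping gives E_Q[L τ] = D E_Q[τ] + E_Q[ω(X 0)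
- ω(X τ)], hence the first bound (`log_inv_le_of_poisson`). If E_Q[τ] is infinite there is nothing
to prove. D is positive because D = 0 would force Q = P, which no test can both accept and reject.

The second bound needs a correction proportional to D, so that it survives division by D and the
infimum over P. Since f_P ≥ 0 has π-mean D, it is at most D/π_* everywhere, and it remains to show
|ω| ≤ C_Q sup |f| (`abs_poissonSol_le`). In L²(π) the operator (Q*)^k Q^k is the Gram operator of
Q^k, so its second eigenvalue controls Q^k on mean-zero functions: the squared norm shrinks by 1 -
kγ at a k attaining the pseudo-spectral gap γ. Bernoulli's inequality bounds this factor by (1 -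
γ)^k, the remainder of n modulo k costs at most 1/γ in the exponent, and passing from L²(π) to the
sup norm costs 1/√π_*. Summing the geometric series yields C_Q. -/

theorem pow_nonneg_entry {m : ℕ} (Q : TransitionMatrix m) (n : ℕ) (i j : Fin m) :
    0 ≤ (Q.1 ^ n) i j :=
  nonneg_of_mem_rowStochastic (pow_mem Q.2 n)

theorem pow_add_entry_pos {m : ℕ} (Q : TransitionMatrix m) {a b : ℕ} {i j l : Fin m}
    (h1 : 0 < (Q.1 ^ a) i l) (h2 : 0 < (Q.1 ^ b) l j) : 0 < (Q.1 ^ (a + b)) i j := by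
  rw [pow_add, Matrix.mul_apply]
  exact Finset.sum_pos' (fun x _ => mul_nonneg (pow_nonneg_entry Q a i x) (pow_nonneg_entry Q b x j))
    ⟨l, Finset.mem_univ l, mul_pos h1 h2⟩

theorem IsErgodic.exists_entry_pos {m : ℕ} {Q : TransitionMatrix m} (h : IsErgodic Q)
    (i j : Fin m) : ∃ k > 0, 0 < (Q.1 ^ k) i j :=
  (Matrix.isIrreducible_iff_exists_pow_pos Q.2.1).1 h.1 i j

/-- The possible return times form an additive submonoid of ℕ whose gcd is 1 by aperiodicity, so it
contains every large integer. -/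
theorem IsErgodic.eventually_return {m : ℕ} {Q : TransitionMatrix m} (h : IsErgodic Q)
    (i : Fin m) : ∃ N, ∀ n ≥ N, 0 < (Q.1 ^ n) i i := by
  let S : AddSubmonoid ℕ :=
    { carrier := {n | 0 < (Q.1 ^ n) i i}
      zero_mem' := by simp
      add_mem' := fun ha hb => pow_add_entry_pos Q ha hb }
  have hg : Nat.setGcd (S : Set ℕ) = 1 :=
    h.2 i _ fun n _ hn => Nat.setGcd_dvd_of_mem (s := (S : Set ℕ)) hn
  obtain ⟨N, hN⟩ := Nat.exists_mem_closure_of_ge (S : Set ℕ)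
  refine ⟨N, fun n hn => ?_⟩
  have := hN n hn (by rw [hg]; exact one_dvd n)
  rw [AddSubmonoid.closure_eq] at this
  exact this

theorem IsErgodic.exists_pow_pos {m : ℕ} {Q : TransitionMatrix m} (h : IsErgodic Q) :
    ∃ k > 0, ∀ i j, 0 < (Q.1 ^ k) i j := by
  choose K hK0 hK using fun i j => h.exists_entry_pos i j
  choose N hN using h.eventually_return
  -- This exponent exceeds every `N i + K i j`; the slack is spent returning to i before the passage
  -- of length `K i j` to j.
  refine ⟨∑ i, ∑ j, (N i + K i j) + 1, by omega, fun i j => ?_⟩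
  have h1 : N i + K i j ≤ ∑ i, ∑ j, (N i + K i j) :=
    (Finset.single_le_sum (f := fun j => N i + K i j) (fun _ _ => Nat.zero_le _)
      (Finset.mem_univ j)).trans
      (Finset.single_le_sum (f := fun i => ∑ j, (N i + K i j)) (fun _ _ => Nat.zero_le _)
        (Finset.mem_univ i))
  obtain ⟨r, hr⟩ := Nat.exists_eq_add_of_le h1
  have : ∑ i, ∑ j, (N i + K i j) + 1 = (N i + r + 1) + K i j := by omega
  rw [this]
  exact pow_add_entry_pos Q (hN i _ (by omega)) (hK i j)

theorem IsStationary.vecMul_pow {m : ℕ} {Q : TransitionMatrix m} {π : ProbVec m}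
    (hπ : IsStationary Q π) (n : ℕ) :
    Matrix.vecMul (fun i => π i) (Q.1 ^ n) = fun i => π i := by
  induction n with
  | zero => simp
  | succ n ih => rw [pow_succ, ← Matrix.vecMul_vecMul, ih, hπ]

theorem IsStationary.pos {m : ℕ} {Q : TransitionMatrix m} {π : ProbVec m}
    (hπ : IsStationary Q π) (h : IsErgodic Q) (j : Fin m) : 0 < π j := by
  have hs : ∑ i, π i = 1 := π.2.2
  obtain ⟨i, -, hi⟩ : ∃ i ∈ Finset.univ, π i ≠ 0 := by
    apply Finset.exists_ne_zero_of_sum_ne_zero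
    rw [hs]; exact one_ne_zero
  have hi' : 0 < π i := lt_of_le_of_ne (π.2.1 i) (Ne.symm hi)
  obtain ⟨k, -, hk⟩ := h.exists_entry_pos i j
  have := congrFun (hπ.vecMul_pow k) j
  rw [← this]
  exact Finset.sum_pos' (fun x _ => mul_nonneg (π.2.1 x) (pow_nonneg_entry Q k x j))
    ⟨i, Finset.mem_univ i, mul_pos hi' hk⟩

/-! ### The weighted square norm -/

/-- The squared norm of `L²(p)`. -/
def wsq {m : ℕ} (p g : Fin m → ℝ) : ℝ := ∑ i, p i * g i ^ 2

theorem wsq_nonneg {m : ℕ} {p : Fin m → ℝ} (hp : ∀ i, 0 ≤ p i) (g : Fin m → ℝ) : 0 ≤ wsq p g :=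
  Finset.sum_nonneg fun i _ => mul_nonneg (hp i) (sq_nonneg _)

theorem le_wsq {m : ℕ} {p : Fin m → ℝ} (hp : ∀ i, 0 ≤ p i) (g : Fin m → ℝ) (i : Fin m) :
    p i * g i ^ 2 ≤ wsq p g :=
  Finset.single_le_sum (f := fun i => p i * g i ^ 2)
    (fun i _ => mul_nonneg (hp i) (sq_nonneg _)) (Finset.mem_univ i)

/-- Second moment equals squared mean plus variance, with the variance written as half the mean
squared difference of two independent draws from r. -/
theorem sq_sum_add_variance {m : ℕ} {r g : Fin m → ℝ} (hr : ∑ j, r j = 1) :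
    (∑ j, r j * g j) ^ 2 + (∑ j, ∑ l, r j * r l * (g j - g l) ^ 2) / 2 = ∑ j, r j * g j ^ 2 := by
  have e1 : ∑ j, ∑ l, r j * r l * (g j - g l) ^ 2 =
      ∑ j, ∑ l, ((r j * g j ^ 2) * r l + r j * (r l * g l ^ 2)
        - 2 * ((r j * g j) * (r l * g l))) := by
    refine Finset.sum_congr rfl fun j _ => Finset.sum_congr rfl fun l _ => by ring
  rw [e1]
  simp only [Finset.sum_sub_distrib, Finset.sum_add_distrib, ← Finset.mul_sum, ← Finset.sum_mul, hr]
  ring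

/-- Law of total variance for one stationary step. Keeping the exact defect gives both contraction
and the equality case. -/
theorem wsq_mulVec_add {m : ℕ} {p : Fin m → ℝ} {R : Matrix (Fin m) (Fin m) ℝ}
    (hR : R ∈ rowStochastic ℝ (Fin m)) (hpR : p ᵥ* R = p) (g : Fin m → ℝ) :
    wsq p (R *ᵥ g) + ∑ i, p i * ((∑ j, ∑ l, R i j * R i l * (g j - g l) ^ 2) / 2) = wsq p g := by
  have h1 : wsq p (R *ᵥ g) + ∑ i, p i * ((∑ j, ∑ l, R i j * R i l * (g j - g l) ^ 2) / 2) =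
      ∑ i, p i * ∑ j, R i j * g j ^ 2 := by
    rw [wsq, ← Finset.sum_add_distrib]
    refine Finset.sum_congr rfl fun i _ => ?_
    rw [← mul_add, ← sq_sum_add_variance (sum_row_of_mem_rowStochastic hR i)]
    rfl
  rw [h1, wsq]
  simp only [Finset.mul_sum]
  rw [Finset.sum_comm]
  refine Finset.sum_congr rfl fun j _ => ?_
  have := congrFun hpR j
  conv_rhs => rw [← this]
  simp only [Matrix.vecMul, dotProduct, Finset.sum_mul]
  exact Finset.sum_congr rfl fun i _ => by ring

theorem wsq_mulVec_le {m : ℕ} {p : Fin m → ℝ} (hp : ∀ i, 0 ≤ p i)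
    {R : Matrix (Fin m) (Fin m) ℝ} (hR : R ∈ rowStochastic ℝ (Fin m)) (hpR : p ᵥ* R = p)
    (g : Fin m → ℝ) : wsq p (R *ᵥ g) ≤ wsq p g := by
  rw [← wsq_mulVec_add hR hpR g, le_add_iff_nonneg_right]
  exact Finset.sum_nonneg fun i _ => mul_nonneg (hp i) (div_nonneg (Finset.sum_nonneg fun j _ =>
    Finset.sum_nonneg fun l _ => mul_nonneg (mul_nonneg (hR.1 i j) (hR.1 i l)) (sq_nonneg _))
    two_pos.le)

/-- No loss of norm means that g has zero variance under every row, and a strictly positive row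
charges both j and l. -/
theorem const_of_wsq_le_wsq_mulVec {m : ℕ} {p : Fin m → ℝ} (hp : ∀ i, 0 < p i)
    {R : Matrix (Fin m) (Fin m) ℝ} (hR : R ∈ rowStochastic ℝ (Fin m)) (hpR : p ᵥ* R = p)
    (hpos : ∀ i j, 0 < R i j) {g : Fin m → ℝ} (h : wsq p g ≤ wsq p (R *ᵥ g)) (j l : Fin m) :
    g j = g l := by
  rw [← wsq_mulVec_add hR hpR g, add_le_iff_nonpos_right] at h
  by_contra hne
  have hsq : 0 < (g j - g l) ^ 2 := by
    have := sub_ne_zero.2 hne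
    positivity
  refine absurd h (not_le.2 ?_)
  have hterm : ∀ i a b, 0 ≤ R i a * R i b * (g a - g b) ^ 2 := fun i a b =>
    mul_nonneg (mul_nonneg (hR.1 i a) (hR.1 i b)) (sq_nonneg _)
  have hin : ∀ i a, 0 ≤ ∑ b, R i a * R i b * (g a - g b) ^ 2 := fun i a =>
    Finset.sum_nonneg fun b _ => hterm i a b
  refine Finset.sum_pos' (fun i _ => mul_nonneg (hp i).le (div_nonneg
    (Finset.sum_nonneg fun a _ => hin i a) two_pos.le)) ⟨j, Finset.mem_univ _, ?_⟩
  refine mul_pos (hp j) (half_pos (Finset.sum_pos' (fun a _ => hin j a) ⟨j, Finset.mem_univ _,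
    Finset.sum_pos' (fun b _ => hterm j j b) ⟨l, Finset.mem_univ _, ?_⟩⟩))
  exact mul_pos (mul_pos (hpos j j) (hpos j l)) hsq

/-! ### The second eigenvalue of a symmetric matrix -/

/-- The second largest eigenvalue (`0` for matrices of size at most one). -/
def secondEigenvalue {m : ℕ} (A : Matrix (Fin m) (Fin m) ℝ) : ℝ :=
  (A.charpoly.roots.sort (· ≥ ·)).getD 1 0

theorem sort_roots_eq_ofFn {m : ℕ} {A : Matrix (Fin m) (Fin m) ℝ} (hA : A.IsHermitian) :
    A.charpoly.roots.sort (· ≥ ·) = List.ofFn hA.eigenvalues₀ := by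
  rw [← hA.sort_roots_charpoly_eq_eigenvalues₀]
  congr 1
  exact (Multiset.map_id _).symm

theorem secondEigenvalue_eq {m : ℕ} {A : Matrix (Fin m) (Fin m) ℝ} (hA : A.IsHermitian)
    (h : 1 < Fintype.card (Fin m)) : secondEigenvalue A = hA.eigenvalues₀ ⟨1, h⟩ := by
  rw [secondEigenvalue, sort_roots_eq_ofFn hA, List.getD_eq_getElem _ _ (by simpa using h)]
  simp

theorem secondEigenvalue_eq_zero {m : ℕ} {A : Matrix (Fin m) (Fin m) ℝ} (hA : A.IsHermitian)
    (h : ¬ 1 < Fintype.card (Fin m)) : secondEigenvalue A = 0 := by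
  rw [secondEigenvalue, sort_roots_eq_ofFn hA, List.getD_eq_default _ _ (by simpa using h)]

/-- `eigenvalues` is the decreasing list `eigenvalues₀` reindexed by an arbitrary bijection; the
hypothesis excludes only the index of the top eigenvalue. -/
theorem eigenvalues_le_secondEigenvalue {m : ℕ} {A : Matrix (Fin m) (Fin m) ℝ}
    (hA : A.IsHermitian) (i : Fin m)
    (hi : ((Fintype.equivOfCardEq (Fintype.card_fin (Fintype.card (Fin m)))).symm i).val ≠ 0) :
    hA.eigenvalues i ≤ secondEigenvalue A := by
  have hlt := ((Fintype.equivOfCardEq (Fintype.card_fin (Fintype.card (Fin m)))).symm i).isLt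
  rw [secondEigenvalue_eq hA (by omega)]
  exact hA.eigenvalues₀_antitone (Fin.mk_le_of_le_val (by omega))

/-- Coordinates in the eigenvector basis. -/
def eigenCoord {m : ℕ} {A : Matrix (Fin m) (Fin m) ℝ} (hA : A.IsHermitian) (h : Fin m → ℝ)
    (i : Fin m) : ℝ :=
  (hA.eigenvectorBasis i : Fin m → ℝ) ⬝ᵥ h

theorem dotProduct_eq_sum_eigenCoord {m : ℕ} {A : Matrix (Fin m) (Fin m) ℝ}
    (hA : A.IsHermitian) (h k : Fin m → ℝ) :
    h ⬝ᵥ k = ∑ i, eigenCoord hA h i * eigenCoord hA k i := by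
  have := hA.eigenvectorBasis.sum_inner_mul_inner (WithLp.toLp 2 h) (WithLp.toLp 2 k)
  simp only [EuclideanSpace.inner_eq_star_dotProduct, star_trivial] at this
  rw [dotProduct_comm, ← this]
  refine Finset.sum_congr rfl fun i _ => ?_
  rw [dotProduct_comm k]
  rfl

theorem eigenCoord_mulVec {m : ℕ} {A : Matrix (Fin m) (Fin m) ℝ}
    (hA : A.IsHermitian) (h : Fin m → ℝ) (i : Fin m) :
    eigenCoord hA (A *ᵥ h) i = hA.eigenvalues i * eigenCoord hA h i := by
  have hT : Aᵀ = A := by simpa [Matrix.IsHermitian] using hA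
  rw [eigenCoord, dotProduct_mulVec, ← mulVec_transpose, hT, hA.mulVec_eigenvectorBasis,
    smul_dotProduct, smul_eq_mul, eigenCoord]

theorem eigenvectorBasis_dotProduct {m : ℕ} {A : Matrix (Fin m) (Fin m) ℝ}
    (hA : A.IsHermitian) (i j : Fin m) :
    (hA.eigenvectorBasis i : Fin m → ℝ) ⬝ᵥ (hA.eigenvectorBasis j : Fin m → ℝ) =
      if i = j then 1 else 0 := by
  have := orthonormal_iff_ite.1 hA.eigenvectorBasis.orthonormal i j
  simp only [EuclideanSpace.inner_eq_star_dotProduct, star_trivial] at this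
  rw [dotProduct_comm]
  exact this

theorem eigenvectorBasis_quadForm {m : ℕ} {A : Matrix (Fin m) (Fin m) ℝ}
    (hA : A.IsHermitian) (i : Fin m) :
    (hA.eigenvectorBasis i : Fin m → ℝ) ⬝ᵥ A *ᵥ (hA.eigenvectorBasis i : Fin m → ℝ) =
      hA.eigenvalues i := by
  rw [hA.mulVec_eigenvectorBasis, dotProduct_smul, eigenvectorBasis_dotProduct]
  simp

theorem quadForm_eq_sum {m : ℕ} {A : Matrix (Fin m) (Fin m) ℝ}
    (hA : A.IsHermitian) (h : Fin m → ℝ) :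
    h ⬝ᵥ A *ᵥ h = ∑ i, hA.eigenvalues i * eigenCoord hA h i ^ 2 := by
  rw [dotProduct_eq_sum_eigenCoord hA]
  refine Finset.sum_congr rfl fun i _ => ?_
  rw [eigenCoord_mulVec]
  ring

theorem secondEigenvalue_nonneg {m : ℕ} {A : Matrix (Fin m) (Fin m) ℝ} (hA : A.IsHermitian)
    (hpsd : ∀ h : Fin m → ℝ, 0 ≤ h ⬝ᵥ A *ᵥ h) : 0 ≤ secondEigenvalue A := by
  by_cases h : 1 < Fintype.card (Fin m)
  · rw [secondEigenvalue_eq hA h]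
    have := eigenvectorBasis_quadForm hA
      (Fintype.equivOfCardEq (Fintype.card_fin (Fintype.card (Fin m))) ⟨1, h⟩)
    rw [Matrix.IsHermitian.eigenvalues, Equiv.symm_apply_apply] at this
    rw [← this]
    exact hpsd _
  · rw [secondEigenvalue_eq_zero hA h]

/-- Otherwise the orthonormal eigenvectors of the two largest eigenvalues would both be multiples of
u, hence parallel. -/
theorem secondEigenvalue_lt_one {m : ℕ} {A : Matrix (Fin m) (Fin m) ℝ} (hA : A.IsHermitian)
    (u : Fin m → ℝ)
    (hu : ∀ h : Fin m → ℝ, h ⬝ᵥ h ≤ h ⬝ᵥ A *ᵥ h → ∃ c : ℝ, h = c • u) :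
    secondEigenvalue A < 1 := by
  by_cases hm : 1 < Fintype.card (Fin m)
  · by_contra! hle
    rw [secondEigenvalue_eq hA hm] at hle
    set e := Fintype.equivOfCardEq (Fintype.card_fin (Fintype.card (Fin m))) with he
    have hval : ∀ k, hA.eigenvalues (e k) = hA.eigenvalues₀ k := fun k => by
      rw [Matrix.IsHermitian.eigenvalues, ← he, Equiv.symm_apply_apply]
    have key : ∀ k : Fin (Fintype.card (Fin m)), k.val ≤ 1 →
        ∃ c : ℝ, (hA.eigenvectorBasis (e k) : Fin m → ℝ) = c • u := by
      intro k hk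
      apply hu
      rw [eigenvectorBasis_quadForm, eigenvectorBasis_dotProduct, hval, if_pos rfl]
      exact hle.trans (hA.eigenvalues₀_antitone (Fin.le_def.2 hk))
    obtain ⟨c0, h0⟩ := key ⟨0, by omega⟩ (by simp)
    obtain ⟨c1, h1⟩ := key ⟨1, hm⟩ le_rfl
    have a00 := eigenvectorBasis_dotProduct hA (e ⟨0, by omega⟩) (e ⟨0, by omega⟩)
    have a11 := eigenvectorBasis_dotProduct hA (e ⟨1, hm⟩) (e ⟨1, hm⟩)
    have a01 := eigenvectorBasis_dotProduct hA (e ⟨0, by omega⟩) (e ⟨1, hm⟩)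
    rw [if_neg (by simp)] at a01
    rw [if_pos rfl] at a00 a11
    rw [h0, smul_dotProduct, dotProduct_smul, smul_eq_mul, smul_eq_mul] at a00
    rw [h1, smul_dotProduct, dotProduct_smul, smul_eq_mul, smul_eq_mul] at a11
    rw [h0, h1, smul_dotProduct, dotProduct_smul, smul_eq_mul, smul_eq_mul] at a01
    -- Parallel vectors give equality in Cauchy–Schwarz, which here reads 1 · 1 = 0.
    have : (c0 * (c0 * (u ⬝ᵥ u))) * (c1 * (c1 * (u ⬝ᵥ u))) = (c0 * (c1 * (u ⬝ᵥ u))) ^ 2 := by ring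
    rw [a00, a11, a01] at this
    norm_num at this
  · rw [secondEigenvalue_eq_zero hA hm]
    exact one_pos

/-- If the second eigenvalue is at least 1, contraction suffices. Otherwise only the first
eigenvalue can equal 1, so the fixed vector u lies along the first eigenvector, and h, being
orthogonal to u, has no component there. -/
theorem quadForm_le_secondEigenvalue {m : ℕ} {A : Matrix (Fin m) (Fin m) ℝ} (hA : A.IsHermitian)
    (hle : ∀ h : Fin m → ℝ, h ⬝ᵥ A *ᵥ h ≤ h ⬝ᵥ h) {u : Fin m → ℝ} (hu0 : u ⬝ᵥ u ≠ 0)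
    (hu : A *ᵥ u = u) {h : Fin m → ℝ} (huh : u ⬝ᵥ h = 0) :
    h ⬝ᵥ A *ᵥ h ≤ secondEigenvalue A * (h ⬝ᵥ h) := by
  rcases le_or_gt 1 (secondEigenvalue A) with h1 | h1
  · refine (hle h).trans (le_mul_of_one_le_left ?_ h1)
    exact Finset.sum_nonneg fun i _ => mul_self_nonneg _
  set e := Fintype.equivOfCardEq (Fintype.card_fin (Fintype.card (Fin m))) with he
  have hz : ∀ i, (e.symm i).val ≠ 0 → eigenCoord hA u i = 0 := by
    intro i hi
    have h2 := eigenCoord_mulVec hA u i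
    rw [hu] at h2
    have h3 := eigenvalues_le_secondEigenvalue hA i hi
    have h4 : (1 - hA.eigenvalues i) * eigenCoord hA u i = 0 := by linarith
    rcases mul_eq_zero.1 h4 with h5 | h5
    · linarith
    · exact h5
  rw [quadForm_eq_sum hA, dotProduct_eq_sum_eigenCoord hA, Finset.mul_sum]
  refine Finset.sum_le_sum fun i _ => ?_
  rw [← pow_two]
  by_cases hi : (e.symm i).val = 0
  · have honly : ∀ j ∈ Finset.univ, j ≠ i → ∀ k : Fin m → ℝ,
        eigenCoord hA u j * eigenCoord hA k j = 0 := by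
      intro j _ hj k
      rw [hz j, zero_mul]
      intro hj0
      exact hj (e.symm.injective (Fin.ext (hj0.trans hi.symm)))
    rw [dotProduct_eq_sum_eigenCoord hA,
      Finset.sum_eq_single i (fun j hj hji => honly j hj hji u) (by simp)] at hu0
    rw [dotProduct_eq_sum_eigenCoord hA,
      Finset.sum_eq_single i (fun j hj hji => honly j hj hji h) (by simp)] at huh
    have : eigenCoord hA h i = 0 := by
      rcases mul_eq_zero.1 huh with h5 | h5
      · exact absurd (by rw [h5, zero_mul]) hu0
      · exact h5
    rw [this]
    simp
  · exact mul_le_mul_of_nonneg_right (eigenvalues_le_secondEigenvalue hA i hi) (sq_nonneg _)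

/-! ### The pseudo-spectral gap -/

/-- `√p R (√p)⁻¹`, the representation of `R` on `L²(p)` in an orthonormal basis. -/
def symmetrized {m : ℕ} (p : Fin m → ℝ) (R : Matrix (Fin m) (Fin m) ℝ) :
    Matrix (Fin m) (Fin m) ℝ :=
  diagonal (fun i => √(p i)) * R * diagonal (fun i => (√(p i))⁻¹)

theorem isHermitian_symmetrized_gram {m : ℕ} (p : Fin m → ℝ) (R : Matrix (Fin m) (Fin m) ℝ) :
    ((symmetrized p R)ᵀ * symmetrized p R).IsHermitian := by
  simp [Matrix.IsHermitian, Matrix.transpose_mul]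

theorem symmetrized_mulVec {m : ℕ} {p : Fin m → ℝ} (hp : ∀ i, 0 < p i)
    (R : Matrix (Fin m) (Fin m) ℝ) (g : Fin m → ℝ) :
    symmetrized p R *ᵥ (fun i => √(p i) * g i) = fun i => √(p i) * (R *ᵥ g) i := by
  rw [symmetrized, ← mulVec_mulVec, ← mulVec_mulVec]
  have : diagonal (fun i => (√(p i))⁻¹) *ᵥ (fun i => √(p i) * g i) = g := by
    ext i
    rw [mulVec_diagonal, inv_mul_cancel_left₀ (Real.sqrt_pos.2 (hp i)).ne']
  rw [this]
  ext i
  rw [mulVec_diagonal]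

theorem dotProduct_sqrt_mul {m : ℕ} {p : Fin m → ℝ} (hp : ∀ i, 0 < p i) (g k : Fin m → ℝ) :
    (fun i => √(p i) * g i) ⬝ᵥ (fun i => √(p i) * k i) = ∑ i, p i * (g i * k i) := by
  refine Finset.sum_congr rfl fun i _ => ?_
  calc √(p i) * g i * (√(p i) * k i) = (√(p i) * √(p i)) * (g i * k i) := by ring
    _ = _ := by rw [Real.mul_self_sqrt (hp i).le]

theorem wsq_eq_dotProduct {m : ℕ} {p : Fin m → ℝ} (hp : ∀ i, 0 < p i) (g : Fin m → ℝ) :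
    (fun i => √(p i) * g i) ⬝ᵥ (fun i => √(p i) * g i) = wsq p g := by
  rw [dotProduct_sqrt_mul hp, wsq]
  simp only [pow_two]

theorem quadForm_gram {m : ℕ} {p : Fin m → ℝ} (hp : ∀ i, 0 < p i)
    (R : Matrix (Fin m) (Fin m) ℝ) (g : Fin m → ℝ) :
    (fun i => √(p i) * g i) ⬝ᵥ ((symmetrized p R)ᵀ * symmetrized p R) *ᵥ
      (fun i => √(p i) * g i) = wsq p (R *ᵥ g) := by
  rw [← mulVec_mulVec, dotProduct_mulVec, vecMul_transpose, symmetrized_mulVec hp,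
    wsq_eq_dotProduct hp]

theorem exists_eq_sqrt_mul {m : ℕ} {p : Fin m → ℝ} (hp : ∀ i, 0 < p i) (h : Fin m → ℝ) :
    ∃ g : Fin m → ℝ, h = fun i => √(p i) * g i :=
  ⟨fun i => (√(p i))⁻¹ * h i, by
    ext i; rw [mul_inv_cancel_left₀ (Real.sqrt_pos.2 (hp i)).ne']⟩

/-- Stochasticity of R fixes √p under the first factor, stationarity of p under the transposed one.
The factor 1 keeps the vector in the shape required by `symmetrized_mulVec`. -/
theorem symmetrized_gram_mulVec_sqrt {m : ℕ} {p : Fin m → ℝ} (hp : ∀ i, 0 < p i)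
    {R : Matrix (Fin m) (Fin m) ℝ} (hR : R ∈ rowStochastic ℝ (Fin m)) (hpR : p ᵥ* R = p) :
    ((symmetrized p R)ᵀ * symmetrized p R) *ᵥ (fun i => √(p i) * 1) = fun i => √(p i) * 1 := by
  have h1 : R *ᵥ (fun _ => 1) = fun _ => 1 := hR.2
  rw [← mulVec_mulVec, symmetrized_mulVec hp R (fun _ => 1), h1, mulVec_transpose, symmetrized,
    ← vecMul_vecMul, ← vecMul_vecMul]
  have h2 : (fun i => √(p i) * 1) ᵥ* diagonal (fun i => √(p i)) = p := by
    ext i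
    rw [vecMul_diagonal, mul_one, Real.mul_self_sqrt (hp i).le]
  rw [h2, hpR]
  ext i
  rw [vecMul_diagonal, mul_one, ← div_eq_mul_inv, Real.div_sqrt]

theorem timeReversal_eq {m : ℕ} (P : TransitionMatrix m) (π : ProbVec m) :
    timeReversal P π = diagonal (fun i => (π i)⁻¹) * P.1ᵀ * diagonal (fun i => π i) := by
  ext i j
  rw [Matrix.mul_diagonal, Matrix.diagonal_mul]
  simp only [timeReversal, Matrix.of_apply, Matrix.transpose_apply]
  ring

theorem timeReversal_pow {m : ℕ} (P : TransitionMatrix m) {π : ProbVec m} (hp : ∀ i, 0 < π i)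
    (k : ℕ) : timeReversal P π ^ k =
      diagonal (fun i => (π i)⁻¹) * (P.1 ^ k)ᵀ * diagonal (fun i => π i) := by
  have h1 : diagonal (fun i => (π i)⁻¹) * diagonal (fun i => π i) = 1 := by
    rw [diagonal_mul_diagonal, ← diagonal_one]
    congr 1
    ext i
    exact inv_mul_cancel₀ (hp i).ne'
  have h2 : diagonal (fun i => π i) * diagonal (fun i => (π i)⁻¹) = 1 := by
    rw [diagonal_mul_diagonal, ← diagonal_one]
    congr 1
    ext i
    exact mul_inv_cancel₀ (hp i).ne'
  induction k with
  | zero => simp [h1]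
  | succ k ih =>
    rw [pow_succ, ih, timeReversal_eq, pow_succ', Matrix.transpose_mul]
    simp only [Matrix.mul_assoc]
    rw [← Matrix.mul_assoc (diagonal fun i => π i) (diagonal fun i => (π i)⁻¹), h2, Matrix.one_mul]

/-- The Gram matrix is a product whose last factor is diag(1/√π); moving that factor to the front
leaves the characteristic polynomial unchanged and produces the time reversal. Hence the
non-symmetric matrix defining the gap has the spectrum of a symmetric one. -/
theorem charpoly_gram {m : ℕ} (P : TransitionMatrix m) {π : ProbVec m} (hp : ∀ i, 0 < π i)
    (k : ℕ) : ((symmetrized (fun i => π i) (P.1 ^ k))ᵀ *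
        symmetrized (fun i => π i) (P.1 ^ k)).charpoly =
      (timeReversal P π ^ k * P.1 ^ k).charpoly := by
  have hd : diagonal (fun i => (√(π i))⁻¹) * diagonal (fun i => (√(π i))⁻¹) =
      diagonal (fun i => (π i)⁻¹) := by
    rw [diagonal_mul_diagonal]
    congr 1
    ext i
    rw [← mul_inv, Real.mul_self_sqrt (hp i).le]
  have hd' : diagonal (fun i => √(π i)) * diagonal (fun i => √(π i)) =
      diagonal (fun i => π i) := by
    rw [diagonal_mul_diagonal]
    congr 1
    ext i
    rw [Real.mul_self_sqrt (hp i).le]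
  rw [timeReversal_pow P hp]
  rw [show (symmetrized (fun i => π i) (P.1 ^ k))ᵀ * symmetrized (fun i => π i) (P.1 ^ k) =
    (diagonal (fun i => (√(π i))⁻¹) * (P.1 ^ k)ᵀ * diagonal (fun i => π i) * P.1 ^ k) *
      diagonal (fun i => (√(π i))⁻¹) from ?_]
  · rw [charpoly_mul_comm, ← hd]
    simp only [Matrix.mul_assoc]
  · simp only [symmetrized, Matrix.transpose_mul, diagonal_transpose, ← hd', Matrix.mul_assoc]

theorem spectralGap_eq {m : ℕ} (P : TransitionMatrix m) {π : ProbVec m} (hp : ∀ i, 0 < π i)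
    (k : ℕ) : spectralGap (timeReversal P π ^ k * P.1 ^ k) =
      1 - secondEigenvalue ((symmetrized (fun i => π i) (P.1 ^ k))ᵀ *
        symmetrized (fun i => π i) (P.1 ^ k)) := by
  rw [secondEigenvalue, charpoly_gram P hp, spectralGap]

theorem spectralGap_le_one {m : ℕ} (P : TransitionMatrix m) {π : ProbVec m} (hp : ∀ i, 0 < π i)
    (k : ℕ) : spectralGap (timeReversal P π ^ k * P.1 ^ k) ≤ 1 := by
  rw [spectralGap_eq P hp, sub_le_self_iff]
  refine secondEigenvalue_nonneg (isHermitian_symmetrized_gram _ _) fun h => ?_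
  obtain ⟨g, rfl⟩ := exists_eq_sqrt_mul hp h
  rw [quadForm_gram hp]
  exact wsq_nonneg (fun i => (hp i).le) _

/-- After multiplication by √π, mean zero under π becomes orthogonality to the fixed vector √π of
the Gram matrix. -/
theorem wsq_pow_le {m : ℕ} {P : TransitionMatrix m} {π : ProbVec m} (hπ : IsStationary P π)
    (hp : ∀ i, 0 < π i) (k : ℕ) {g : Fin m → ℝ} (hg : ∑ i, π i * g i = 0) :
    wsq (fun i => π i) (P.1 ^ k *ᵥ g) ≤
      (1 - spectralGap (timeReversal P π ^ k * P.1 ^ k)) * wsq (fun i => π i) g := by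
  rw [spectralGap_eq P hp, sub_sub_cancel, ← wsq_eq_dotProduct hp g, ← quadForm_gram hp]
  refine quadForm_le_secondEigenvalue (isHermitian_symmetrized_gram _ _) (fun h => ?_)
    (u := fun i => √(π i) * 1) ?_ ?_ ?_
  · obtain ⟨g, rfl⟩ := exists_eq_sqrt_mul hp h
    rw [quadForm_gram hp, wsq_eq_dotProduct hp]
    exact wsq_mulVec_le (fun i => (hp i).le) (pow_mem P.2 k) (hπ.vecMul_pow k) g
  · rw [dotProduct_sqrt_mul hp]
    simp only [mul_one]
    rw [show ∑ i, π i = 1 from π.2.2]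
    exact one_ne_zero
  · exact symmetrized_gram_mulVec_sqrt hp (pow_mem P.2 k) (hπ.vecMul_pow k)
  · rw [dotProduct_sqrt_mul hp]
    simpa only [one_mul] using hg

theorem spectralGap_pos {m : ℕ} {P : TransitionMatrix m} {π : ProbVec m} (hπ : IsStationary P π)
    (hp : ∀ i, 0 < π i) {k : ℕ} (hk : ∀ i j, 0 < (P.1 ^ k) i j) :
    0 < spectralGap (timeReversal P π ^ k * P.1 ^ k) := by
  rw [spectralGap_eq P hp, sub_pos]
  refine secondEigenvalue_lt_one (isHermitian_symmetrized_gram _ _) (fun i => √(π i)) fun h hh => ?_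
  obtain ⟨g, rfl⟩ := exists_eq_sqrt_mul hp h
  rw [quadForm_gram hp, wsq_eq_dotProduct hp] at hh
  have hc := const_of_wsq_le_wsq_mulVec hp (pow_mem P.2 k) (hπ.vecMul_pow k) hk hh
  rcases isEmpty_or_nonempty (Fin m) with hm | ⟨⟨i0⟩⟩
  · exact ⟨0, Subsingleton.elim _ _⟩
  · refine ⟨g i0, funext fun i => ?_⟩
    rw [Pi.smul_apply, smul_eq_mul, hc i i0, mul_comm]

/-- The supremum defining the pseudo-spectral gap of an ergodic chain is attained, and positive. -/
theorem exists_pseudoGap_eq {m : ℕ} {P : TransitionMatrix m} {π : ProbVec m}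
    (hP : IsErgodic P) (hπ : IsStationary P π) :
    0 < pseudoGap P π ∧ ∃ k : ℕ, 0 < k ∧
      k * pseudoGap P π = spectralGap (timeReversal P π ^ k * P.1 ^ k) := by
  have hp := hπ.pos hP
  set G : ℕ → ℝ := fun k => spectralGap (timeReversal P π ^ k * P.1 ^ k) / k with hG
  have hG1 : ∀ k : ℕ, G k ≤ 1 / k := fun k =>
    div_le_div_of_nonneg_right (spectralGap_le_one P hp k) (Nat.cast_nonneg k)
  obtain ⟨k1, hk1, hk1pos⟩ := hP.exists_pow_pos
  have hk1' : 0 < G k1 := div_pos (spectralGap_pos hπ hp hk1pos) (Nat.cast_pos.2 hk1)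
  -- Since the terms are at most 1/k and one of them is positive, all terms beyond K are smaller
  -- than that one, so the supremum is a maximum over a finite range.
  obtain ⟨K, hK⟩ := exists_nat_one_div_lt hk1'
  obtain ⟨k, hk, hmax⟩ := Finset.exists_max_image (Finset.Icc 1 (max k1 K)) G
    ⟨k1, by simp; omega⟩
  have hkk1 : G k1 ≤ G k := hmax k1 (by simp; omega)
  have hall : ∀ l : ℕ, 0 < l → G l ≤ G k := by
    intro l hl
    by_cases hlK : l ≤ max k1 K
    · exact hmax l (Finset.mem_Icc.2 ⟨hl, hlK⟩)
    · have hKl : ((K : ℝ) + 1) ≤ l := by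
        have : K + 1 ≤ l := by omega
        exact_mod_cast this
      exact (hG1 l).trans (((one_div_le_one_div_of_le (by positivity) hKl).trans hK.le).trans hkk1)
  have hk0 : 0 < k := (Finset.mem_Icc.1 hk).1
  have heq : pseudoGap P π = G k := by
    apply le_antisymm
    · exact ciSup_le fun l => hall l l.2
    · exact le_ciSup (f := fun l : ℕ+ => G l) ⟨G k, by
        rintro _ ⟨l, rfl⟩; exact hall l l.2⟩ ⟨k, hk0⟩
  refine ⟨heq ▸ hk1'.trans_le hkk1, k, hk0, ?_⟩
  rw [heq, hG]
  have : (k : ℝ) ≠ 0 := by positivity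
  field_simp

theorem pseudoGap_le_one {m : ℕ} {P : TransitionMatrix m} {π : ProbVec m}
    (hP : IsErgodic P) (hπ : IsStationary P π) : pseudoGap P π ≤ 1 := by
  obtain ⟨h0, k, hk, hkeq⟩ := exists_pseudoGap_eq hP hπ
  have h1 := spectralGap_le_one P (hπ.pos hP) k
  have h2 : (1 : ℝ) ≤ k := by exact_mod_cast hk
  nlinarith

/-! ### Convergence to equilibrium -/

theorem sum_weight_mulVec_pow {m : ℕ} {P : TransitionMatrix m} {π : ProbVec m}
    (hπ : IsStationary P π) (n : ℕ) (g : Fin m → ℝ) :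
    ∑ i, π i * (P.1 ^ n *ᵥ g) i = ∑ i, π i * g i := by
  have := dotProduct_mulVec (fun i => π i) (P.1 ^ n) g
  rw [hπ.vecMul_pow] at this
  exact this

theorem wsq_pow_mul_le {m : ℕ} {P : TransitionMatrix m} {π : ProbVec m}
    (hπ : IsStationary P π) {k : ℕ} {c : ℝ} (hc : 0 ≤ c)
    (h : ∀ g : Fin m → ℝ, ∑ i, π i * g i = 0 →
      wsq (fun i => π i) (P.1 ^ k *ᵥ g) ≤ c * wsq (fun i => π i) g)
    (q : ℕ) {g : Fin m → ℝ} (hg : ∑ i, π i * g i = 0) :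
    wsq (fun i => π i) (P.1 ^ (k * q) *ᵥ g) ≤ c ^ q * wsq (fun i => π i) g := by
  induction q with
  | zero => simp
  | succ q ih =>
    rw [Nat.mul_succ, add_comm (k * q), pow_add, ← mulVec_mulVec, pow_succ', mul_assoc]
    exact (h _ (by rw [sum_weight_mulVec_pow hπ, hg])).trans (mul_le_mul_of_nonneg_left ih hc)

/-- Write n = kq + r with k attaining the gap: the q blocks each contract, and the remaining r steps
do not increase the norm. -/
theorem wsq_pow_le_rpow {m : ℕ} {P : TransitionMatrix m} {π : ProbVec m}
    (hP : IsErgodic P) (hπ : IsStationary P π) (hlt : pseudoGap P π < 1) (n : ℕ)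
    {g : Fin m → ℝ} (hg : ∑ i, π i * g i = 0) :
    wsq (fun i => π i) (P.1 ^ n *ᵥ g) ≤
      (1 - pseudoGap P π) ^ (n - 1 / pseudoGap P π : ℝ) * wsq (fun i => π i) g := by
  obtain ⟨h0, k, hk, hkeq⟩ := exists_pseudoGap_eq hP hπ
  have hp := hπ.pos hP
  have hkle : k * pseudoGap P π ≤ 1 := hkeq ▸ spectralGap_le_one P hp k
  have hstep := fun g hg => wsq_pow_le hπ hp k (g := g) hg
  rw [← hkeq] at hstep
  set γ := pseudoGap P π with hγ
  -- Bernoulli's inequality makes the decay rate per step independent of k.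
  have hbern : 1 - k * γ ≤ (1 - γ) ^ k := by
    have := one_add_mul_le_pow (a := -γ) (by linarith) k
    calc 1 - k * γ = 1 + k * (-γ) := by ring
      _ ≤ (1 + -γ) ^ k := this
      _ = _ := by rw [sub_eq_add_neg]
  have hw := wsq_nonneg (p := fun i => π i) (fun i => (hp i).le) g
  have hq := wsq_pow_mul_le hπ (by linarith) hstep (n / k) hg
  have hn : P.1 ^ n = P.1 ^ (n % k) * P.1 ^ (k * (n / k)) := by
    rw [← pow_add, Nat.mod_add_div]
  rw [hn, ← mulVec_mulVec]
  refine (wsq_mulVec_le (fun i => (hp i).le) (pow_mem P.2 _) (hπ.vecMul_pow _) _).trans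
    (hq.trans (mul_le_mul_of_nonneg_right ?_ hw))
  refine (pow_le_pow_left₀ (by linarith) hbern _).trans ?_
  rw [← pow_mul, ← Real.rpow_natCast]
  apply Real.rpow_le_rpow_of_exponent_ge (by linarith) (by linarith)
  -- The gap at k is kγ ≤ 1, so kq ≥ n - k ≥ n - 1/γ; the base is at most 1, so the larger exponent
  -- gives the smaller power.
  have h1 : (k : ℝ) ≤ 1 / γ := by rw [le_div_iff₀ h0]; exact hkle
  have h2 : (n : ℝ) ≤ (k * (n / k) : ℕ) + k := by
    have := Nat.mod_add_div n k
    have := Nat.mod_lt n hk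
    exact_mod_cast (by omega : n ≤ k * (n / k) + k)
  linarith

/-! ### The Poisson equation -/

/-- The recentring `f - (π f) 1`. -/
def centered {m : ℕ} (π : ProbVec m) (f : Fin m → ℝ) : Fin m → ℝ :=
  fun i => f i - ∑ j, π j * f j

theorem sum_weight_centered {m : ℕ} (π : ProbVec m) (f : Fin m → ℝ) :
    ∑ i, π i * centered π f i = 0 := by
  simp only [centered, mul_sub, Finset.sum_sub_distrib, ← Finset.sum_mul]
  rw [show ∑ i, π i = 1 from π.2.2, one_mul, sub_self]

/-- Since powers of P fix constants, subtracting the projection onto constants amounts to centering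
f first. -/
theorem poissonSol_term {m : ℕ} (P : TransitionMatrix m) (π : ProbVec m) (f : Fin m → ℝ) (n : ℕ) :
    (P.1 ^ n - Matrix.of fun _ j => π j) *ᵥ f = P.1 ^ n *ᵥ centered π f := by
  have h1 : centered π f = f - (∑ j, π j * f j) • (1 : Fin m → ℝ) := by
    ext i; simp [centered]
  have h2 : P.1 ^ n *ᵥ (1 : Fin m → ℝ) = 1 := (pow_mem P.2 n).2
  rw [h1, mulVec_sub, mulVec_smul, h2, sub_mulVec]
  congr 1
  ext i
  simp [Matrix.mulVec, dotProduct]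

theorem abs_le_of_wsq_le {m : ℕ} {p : Fin m → ℝ} {c : ℝ} (hc : 0 < c) (hp : ∀ i, c ≤ p i)
    {g : Fin m → ℝ} {a B : ℝ} (hB : 0 ≤ B) (h : wsq p g ≤ a * B ^ 2) (i : Fin m) :
    |g i| ≤ √a * B / √c := by
  have h1 : c * g i ^ 2 ≤ a * B ^ 2 :=
    (mul_le_mul_of_nonneg_right (hp i) (sq_nonneg _)).trans
      ((le_wsq (fun i => hc.le.trans (hp i)) g i).trans h)
  rw [le_div_iff₀ (Real.sqrt_pos.2 hc), ← Real.sqrt_sq_eq_abs, ← Real.sqrt_mul (sq_nonneg _)]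
  calc √(g i ^ 2 * c) ≤ √(a * B ^ 2) := Real.sqrt_le_sqrt (by linarith)
    _ = √a * B := by rw [Real.sqrt_mul' _ (sq_nonneg _), Real.sqrt_sq hB]

theorem wsq_centered_le {m : ℕ} {π : ProbVec m} {f : Fin m → ℝ} {B : ℝ} (hB : ∀ i, |f i| ≤ B) :
    wsq (fun i => π i) (centered π f) ≤ B ^ 2 := by
  have hs : ∑ i, π i = 1 := π.2.2
  have h1 : wsq (fun i => π i) (centered π f) =
      ∑ i, π i * f i ^ 2 - (∑ i, π i * f i) ^ 2 := by
    have h2 : ∀ i, π i * centered π f i ^ 2 = π i * f i ^ 2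
        - 2 * (∑ j, π j * f j) * (π i * f i) + (∑ j, π j * f j) ^ 2 * π i := fun i => by
      rw [centered]; ring
    simp only [wsq, h2, Finset.sum_add_distrib, Finset.sum_sub_distrib, ← Finset.mul_sum, hs]
    ring
  have h3 : ∑ i, π i * f i ^ 2 ≤ ∑ i, π i * B ^ 2 := Finset.sum_le_sum fun i _ =>
    mul_le_mul_of_nonneg_left (sq_le_sq' (abs_le.1 (hB i)).1 (abs_le.1 (hB i)).2) (π.2.1 i)
  rw [← Finset.sum_mul, hs, one_mul] at h3
  nlinarith [sq_nonneg (∑ i, π i * f i)]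

theorem minWeight_le {m : ℕ} (π : ProbVec m) (i : Fin m) : minWeight π ≤ π i :=
  ciInf_le (Set.finite_range _).bddBelow i

theorem minWeight_pos {m : ℕ} [Nonempty (Fin m)] {π : ProbVec m} (hp : ∀ i, 0 < π i) :
    0 < minWeight π := by
  obtain ⟨i, hi⟩ := exists_eq_ciInf_of_finite (f := fun i => π i)
  rw [minWeight, ← hi]
  exact hp i

/-- A geometric majorant uniform in the state gives both convergence of the series and its bound.
Its ratio is √(1 - γ), because the L² estimate concerns squared norms. -/
theorem poissonSol_bound_of_lt {m : ℕ} [Nonempty (Fin m)] {P : TransitionMatrix m}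
    {π : ProbVec m} (hP : IsErgodic P) (hπ : IsStationary P π) (hlt : pseudoGap P π < 1)
    {f : Fin m → ℝ} {B : ℝ} (hB0 : 0 ≤ B) (hB : ∀ i, |f i| ≤ B) :
    ∃ b : ℕ → ℝ, (∀ n i, |(P.1 ^ n *ᵥ centered π f) i| ≤ b n) ∧
      HasSum b (poissonConst P π * B) := by
  obtain ⟨h0, -⟩ := exists_pseudoGap_eq hP hπ
  have hp := hπ.pos hP
  have hmin := minWeight_pos hp
  set γ := pseudoGap P π with hγ
  have hr0 : 0 < 1 - γ := by linarith
  have hr1 : √(1 - γ) < 1 := by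
    rw [Real.sqrt_lt' one_pos]; linarith
  refine ⟨fun n => (1 - γ) ^ (-(1 / (2 * γ))) / √(minWeight π) * B * √(1 - γ) ^ n, fun n i => ?_, ?_⟩
  · have h1 := (wsq_pow_le_rpow hP hπ hlt n (sum_weight_centered π f)).trans
      (mul_le_mul_of_nonneg_left (wsq_centered_le hB) (Real.rpow_nonneg hr0.le _))
    refine (abs_le_of_wsq_le hmin (minWeight_le π) hB0 h1 i).trans (le_of_eq ?_)
    have h2 : √((1 - γ) ^ (n - 1 / γ : ℝ)) = (1 - γ) ^ (-(1 / (2 * γ))) * √(1 - γ) ^ n := by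
      rw [Real.sqrt_eq_rpow, Real.sqrt_eq_rpow, ← Real.rpow_natCast, ← Real.rpow_mul hr0.le,
        ← Real.rpow_mul hr0.le, ← Real.rpow_add hr0]
      congr 1
      field_simp
      ring
    rw [← hγ, h2]
    ring
  · have hg := (hasSum_geometric_of_lt_one (Real.sqrt_nonneg (1 - γ)) hr1).mul_left
      ((1 - γ) ^ (-(1 / (2 * γ))) / √(minWeight π) * B)
    rw [poissonConst, if_neg hlt.ne, ← hγ, one_div (1 - √(1 - γ))]
    rw [mul_right_comm]
    exact hg

/-- A gap equal to k and at most 1 forces k = 1 and second eigenvalue 0, so P annihilates mean-zero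
functions. Only the term n = 0 survives, and centering at most doubles the sup norm. -/
theorem poissonSol_bound_of_eq {m : ℕ} {P : TransitionMatrix m}
    {π : ProbVec m} (hP : IsErgodic P) (hπ : IsStationary P π) (h1 : pseudoGap P π = 1)
    {f : Fin m → ℝ} {B : ℝ} (hB : ∀ i, |f i| ≤ B) :
    ∃ b : ℕ → ℝ, (∀ n i, |(P.1 ^ n *ᵥ centered π f) i| ≤ b n) ∧
      HasSum b (poissonConst P π * B) := by
  obtain ⟨-, k, hk, hkeq⟩ := exists_pseudoGap_eq hP hπ
  have hp := hπ.pos hP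
  have hle := spectralGap_le_one P hp k
  rw [h1, mul_one] at hkeq
  rw [← hkeq] at hle
  have hk1 : k = 1 := by
    have : k ≤ 1 := by exact_mod_cast hle
    omega
  subst hk1
  have hz : P.1 *ᵥ centered π f = 0 := by
    have h2 := wsq_pow_le hπ hp 1 (sum_weight_centered π f)
    rw [← hkeq, pow_one] at h2
    ext i
    have h3 := (le_wsq (p := fun i => π i) (fun i => (hp i).le) (P.1 *ᵥ centered π f) i).trans h2
    simp only [Nat.cast_one, sub_self, zero_mul] at h3
    have h4 : (P.1 *ᵥ centered π f) i ^ 2 ≤ 0 := by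
      by_contra! hc
      exact absurd h3 (not_le.2 (mul_pos (hp i) hc))
    exact pow_eq_zero_iff two_ne_zero |>.1 (le_antisymm h4 (sq_nonneg _))
  refine ⟨fun n => if n = 0 then poissonConst P π * B else 0, fun n i => ?_, ?_⟩
  · rcases n with _ | n
    · rw [pow_zero, one_mulVec]
      simp only [if_true]
      rw [poissonConst, if_pos h1, centered, two_mul]
      refine (abs_sub _ _).trans (add_le_add (hB i) ?_)
      calc |∑ j, π j * f j| ≤ ∑ j, |π j * f j| := Finset.abs_sum_le_sum_abs _ _
        _ ≤ ∑ j, π j * B := Finset.sum_le_sum fun j _ => by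
            rw [abs_mul, abs_of_nonneg (hp j).le]
            exact mul_le_mul_of_nonneg_left (hB j) (hp j).le
        _ = B := by rw [← Finset.sum_mul, show ∑ j, π j = 1 from π.2.2, one_mul]
    · rw [pow_succ, ← mulVec_mulVec, hz]
      simp
  · exact hasSum_ite_eq 0 _

theorem exists_poissonSol_bound {m : ℕ} [Nonempty (Fin m)] {P : TransitionMatrix m}
    {π : ProbVec m} (hP : IsErgodic P) (hπ : IsStationary P π)
    {f : Fin m → ℝ} {B : ℝ} (hB0 : 0 ≤ B) (hB : ∀ i, |f i| ≤ B) :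
    ∃ b : ℕ → ℝ, (∀ n i, |(P.1 ^ n *ᵥ centered π f) i| ≤ b n) ∧
      HasSum b (poissonConst P π * B) := by
  rcases (pseudoGap_le_one hP hπ).lt_or_eq with h | h
  · exact poissonSol_bound_of_lt hP hπ h hB0 hB
  · exact poissonSol_bound_of_eq hP hπ h hB

theorem hasSum_poissonSol {m : ℕ} [Nonempty (Fin m)] {P : TransitionMatrix m}
    {π : ProbVec m} (hP : IsErgodic P) (hπ : IsStationary P π) (f : Fin m → ℝ) (i : Fin m) :
    HasSum (fun n => (P.1 ^ n *ᵥ centered π f) i) (poissonSol P π f i) := by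
  obtain ⟨b, hb, hbs⟩ := exists_poissonSol_bound hP hπ (f := f) (B := ∑ j, |f j|)
    (Finset.sum_nonneg fun _ _ => abs_nonneg _)
    (fun i => Finset.single_le_sum (f := fun j => |f j|) (fun _ _ => abs_nonneg _)
      (Finset.mem_univ i))
  have hs : Summable fun n => P.1 ^ n *ᵥ centered π f :=
    Pi.summable.2 fun i => Summable.of_norm_bounded (g := b) hbs.summable fun n => (Real.norm_eq_abs _).trans_le (hb n i)
  have := Pi.hasSum.1 hs.hasSum i
  simpa only [poissonSol, poissonSol_term] using this

theorem abs_poissonSol_le {m : ℕ} [Nonempty (Fin m)] {P : TransitionMatrix m}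
    {π : ProbVec m} (hP : IsErgodic P) (hπ : IsStationary P π)
    {f : Fin m → ℝ} {B : ℝ} (hB0 : 0 ≤ B) (hB : ∀ i, |f i| ≤ B) (i : Fin m) :
    |poissonSol P π f i| ≤ poissonConst P π * B := by
  obtain ⟨b, hb, hbs⟩ := exists_poissonSol_bound hP hπ hB0 hB
  rw [← (hasSum_poissonSol hP hπ f i).tsum_eq]
  exact tsum_of_norm_bounded hbs fun n => (Real.norm_eq_abs _).trans_le (hb n i)

/-- Applying P shifts the series by one index, so the difference is its first term, the centered f.
-/
theorem poisson_equation {m : ℕ} [Nonempty (Fin m)] {P : TransitionMatrix m}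
    {π : ProbVec m} (hP : IsErgodic P) (hπ : IsStationary P π) (f : Fin m → ℝ) (i : Fin m) :
    poissonSol P π f i - (P.1 *ᵥ poissonSol P π f) i = f i - ∑ j, π j * f j := by
  have h1 := hasSum_poissonSol hP hπ f i
  have h2 : HasSum (fun n => (P.1 ^ (n + 1) *ᵥ centered π f) i)
      ((P.1 *ᵥ poissonSol P π f) i) := by
    have := hasSum_sum (s := Finset.univ) fun j _ =>
      (hasSum_poissonSol hP hπ f j).mul_left (P.1 i j)
    simpa only [pow_succ', ← mulVec_mulVec] using! this
  have h3 := (hasSum_nat_add_iff (f := fun n => (P.1 ^ n *ᵥ centered π f) i) 1).1 h2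
  rw [h1.unique h3]
  simp [centered]

/-! ### One-step conditioning and change of measure -/

instance {m : ℕ} (P : TransitionMatrix m) (μ : ProbVec m) :
    IsProbabilityMeasure (chainLaw P μ) := by
  unfold chainLaw
  infer_instance

theorem integral_toMeasure {m : ℕ} (p : ProbVec m) (f : Fin m → ℝ) :
    ∫ j, f j ∂(toMeasure p) = ∑ j, p j * f j := by
  rw [toMeasure, integral_finsetSum_measure fun i _ =>
    Integrable.of_finite.smul_measure ENNReal.ofReal_ne_top]
  refine Finset.sum_congr rfl fun i _ => ?_
  have hi : 0 ≤ p i := p.2.1 i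
  rw [integral_smul_measure, integral_dirac, ENNReal.toReal_ofReal hi, smul_eq_mul]

theorem exists_preimage_frestrictLe {m : ℕ} {n : ℕ} {A : Set (ℕ → Fin m)}
    (hA : MeasurableSet[Filtration.piLE (X := fun _ : ℕ => Fin m) n] A) :
    ∃ B : Set ((i : Finset.Iic n) → (fun _ : ℕ => Fin m) i),
      A = Preorder.frestrictLe (π := fun _ => Fin m) n ⁻¹' B := by
  rw [Filtration.piLE_eq_comap_frestrictLe] at hA
  obtain ⟨B, -, hB⟩ := hA
  exact ⟨B, hB.symm⟩

/-- Martingale difference property: the event depends on the first n + 1 states, and given these the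
next state has law `row Q` at the current one, under which g has mean zero. -/
theorem setIntegral_step_eq_zero {m : ℕ} (Q : TransitionMatrix m) (μ : ProbVec m) {n : ℕ}
    {A : Set (ℕ → Fin m)} (hA : MeasurableSet[Filtration.piLE (X := fun _ : ℕ => Fin m) n] A)
    {g : Fin m → Fin m → ℝ} (hg : ∀ i, ∑ j, Q.1 i j * g i j = 0) :
    ∫ x, A.indicator (fun x => g (x n) (x (n + 1))) x ∂(chainLaw Q μ) = 0 := by
  obtain ⟨B, rfl⟩ := exists_preimage_frestrictLe hA
  have key := Kernel.map_frestrictLe_trajMeasure_compProd_eq_map_trajMeasure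
    (X := fun _ => Fin m) (μ₀ := toMeasure μ) (κ := stepKernel Q) (a := n)
  let φ : ((i : Finset.Iic n) → (fun _ : ℕ => Fin m) i) × Fin m → ℝ := fun y =>
    B.indicator (fun z => g (z ⟨n, Finset.mem_Iic.2 le_rfl⟩) y.2) y.1
  have hφ : ∀ x : ℕ → Fin m, (Preorder.frestrictLe (π := fun _ => Fin m) n ⁻¹' B).indicator
      (fun x => g (x n) (x (n + 1))) x =
      φ (Preorder.frestrictLe (π := fun _ => Fin m) n x, x (n + 1)) := fun x => rfl
  simp_rw [hφ]
  rw [← integral_map (μ := chainLaw Q μ)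
    (φ := fun x => (Preorder.frestrictLe (π := fun _ => Fin m) n x, x (n + 1)))
    (f := φ) (by fun_prop) (Measurable.of_discrete.aestronglyMeasurable)]
  rw [chainLaw, ← key, Measure.integral_compProd Integrable.of_finite]
  refine integral_eq_zero_of_ae (Filter.Eventually.of_forall fun y => ?_)
  by_cases hy : y ∈ B
  · have : ∫ z, φ (y, z) ∂(toMeasure (row Q (y ⟨n, Finset.mem_Iic.2 le_rfl⟩))) = 0 := by
      rw [integral_toMeasure]
      simp only [φ, Set.indicator_of_mem hy]
      exact hg _
    exact this
  · simp [φ, Set.indicator_of_notMem hy]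

/-- The log-likelihood ratio of the first `n` transitions. -/
def logLik {m : ℕ} (Q P : TransitionMatrix m) (n : ℕ) (x : ℕ → Fin m) : ℝ :=
  ∑ t ∈ Finset.range n, Real.log (Q.1 (x t) (x (t + 1)) / P.1 (x t) (x (t + 1)))

/-- Transition by transition, the factor P/Q cancels against Q. Only an inequality holds: a
transition impossible under Q gives 0 on the left but may have positive probability under P. -/
theorem exp_neg_logLik_mul_cylinder_le {m : ℕ} {Q P : TransitionMatrix m} (hac : RowAC Q P)
    (μ : ProbVec m) (n : ℕ) (a : ℕ → Fin m) :
    ENNReal.ofReal (Real.exp (-logLik Q P n a)) * chainLaw Q μ {x | ∀ i ≤ n, x i = a i} ≤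
      chainLaw P μ {x | ∀ i ≤ n, x i = a i} := by
  rw [chainLaw_cylinder, chainLaw_cylinder, logLik, ← Finset.sum_neg_distrib, Real.exp_sum,
    ENNReal.ofReal_prod_of_nonneg fun _ _ => (Real.exp_pos _).le, mul_left_comm,
    ← Finset.prod_mul_distrib]
  refine mul_le_mul_right (Finset.prod_le_prod' fun t _ => ?_) _
  rw [← ENNReal.ofReal_mul (Real.exp_pos _).le]
  apply ENNReal.ofReal_le_ofReal
  have hP := P.2.1 (a t) (a (t + 1))
  rcases (Q.2.1 (a t) (a (t + 1))).eq_or_lt with h0 | h0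
  · rw [← h0, mul_zero]; exact hP
  · have hP' : 0 < P.1 (a t) (a (t + 1)) :=
      lt_of_le_of_ne hP fun h => h0.ne' (hac _ _ h.symm)
    rw [Real.exp_neg, Real.exp_log (div_pos h0 hP'), inv_div, div_mul_cancel₀ _ h0.ne']

theorem lintegral_exp_neg_logLik_le {m : ℕ} {Q P : TransitionMatrix m} (hac : RowAC Q P)
    (μ : ProbVec m) {n : ℕ} {A : Set (ℕ → Fin m)}
    (hA : MeasurableSet[Filtration.piLE (X := fun _ : ℕ => Fin m) n] A) :
    ∫⁻ x in A, ENNReal.ofReal (Real.exp (-logLik Q P n x)) ∂(chainLaw Q μ) ≤ chainLaw P μ A := by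
  have hAm : MeasurableSet A := (Filtration.piLE (X := fun _ : ℕ => Fin m)).le n _ hA
  obtain ⟨B, rfl⟩ := exists_preimage_frestrictLe hA
  -- Extends a finite history to a path by freezing it at time n; the events and `logLik` up to n do
  -- not see the extension.
  let e : ((i : Finset.Iic n) → Fin m) → ℕ → Fin m := fun y t =>
    y ⟨min t n, Finset.mem_Iic.2 (min_le_right _ _)⟩
  let ρ : (ℕ → Fin m) → ((i : Finset.Iic n) → Fin m) :=
    Preorder.frestrictLe (π := fun _ => Fin m) n
  have hρ : Measurable ρ := by fun_prop
  have hB : MeasurableSet B := MeasurableSet.of_discrete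
  have hL : ∀ x : ℕ → Fin m, logLik Q P n x = logLik Q P n (e (ρ x)) := by
    intro x
    refine Finset.sum_congr rfl fun t ht => ?_
    have ht' := Finset.mem_range.1 ht
    simp only [e, ρ, Preorder.frestrictLe_apply]
    rw [min_eq_left (by omega : t ≤ n), min_eq_left (by omega : t + 1 ≤ n)]
  have he : ∀ y i (hi : i ≤ n), e y i = y ⟨i, Finset.mem_Iic.2 hi⟩ := fun y i hi =>
    congrArg y (Subtype.ext (min_eq_left hi))
  have hcyl : ∀ y, ρ ⁻¹' {y} = {x | ∀ i ≤ n, x i = e y i} := by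
    intro y
    ext x
    simp only [Set.mem_preimage, Set.mem_singleton_iff, Set.mem_ofPred_eq, funext_iff]
    exact ⟨fun h i hi => (h ⟨i, Finset.mem_Iic.2 hi⟩).trans (he y i hi).symm,
      fun h i => (h i (Finset.mem_Iic.1 i.2)).trans (he y i (Finset.mem_Iic.1 i.2))⟩
  have h1 : ∫⁻ x in ρ ⁻¹' B, ENNReal.ofReal (Real.exp (-logLik Q P n x)) ∂(chainLaw Q μ) =
      ∫⁻ y in B, ENNReal.ofReal (Real.exp (-logLik Q P n (e y))) ∂((chainLaw Q μ).map ρ) := by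
    rw [setLIntegral_map hB Measurable.of_discrete hρ]
    exact lintegral_congr fun x => by rw [hL]
  have h2 : chainLaw P μ (ρ ⁻¹' B) = ∫⁻ y in B, 1 ∂((chainLaw P μ).map ρ) := by
    rw [setLIntegral_one, Measure.map_apply hρ hB]
  change ∫⁻ x in ρ ⁻¹' B, _ ∂_ ≤ chainLaw P μ (ρ ⁻¹' B)
  rw [h1, h2, ← lintegral_indicator hB, ← lintegral_indicator hB, lintegral_fintype,
    lintegral_fintype]
  refine Finset.sum_le_sum fun y _ => ?_
  by_cases hy : y ∈ B
  · rw [Set.indicator_of_mem hy, Set.indicator_of_mem hy, one_mul,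
      Measure.map_apply hρ (MeasurableSet.singleton y),
      Measure.map_apply hρ (MeasurableSet.singleton y), hcyl]
    exact exp_neg_logLik_mul_cylinder_le hac μ n (e y)
  · simp [Set.indicator_of_notMem hy]

/-! ### Stopping times -/

section Stopping

variable {m : ℕ} {τ : (ℕ → Fin m) → ℕ∞}

theorem measurableSet_piLE_lt
    (hτ : IsStoppingTime (Filtration.piLE (X := fun _ : ℕ => Fin m)) τ) (n : ℕ) :
    MeasurableSet[Filtration.piLE (X := fun _ : ℕ => Fin m) n] {x | τ x ≤ n}ᶜ :=
  MeasurableSet.compl (hτ n)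

theorem measurableSet_eq_natCast
    (hτ : IsStoppingTime (Filtration.piLE (X := fun _ : ℕ => Fin m)) τ) (n : ℕ) :
    MeasurableSet[Filtration.piLE (X := fun _ : ℕ => Fin m) n] {x | τ x = n} :=
  hτ.measurableSet_eq n

theorem setOf_lt_top_eq_iUnion : {x | τ x < ⊤} = ⋃ n : ℕ, {x | τ x = n} := by
  ext x
  simp only [Set.mem_ofPred_eq, Set.mem_iUnion]
  constructor
  · intro h
    exact ⟨(τ x).toNat, (ENat.natCast_toNat h.ne).symm⟩
  · rintro ⟨n, hn⟩
    rw [hn]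
    exact ENat.natCast_lt_top n

theorem measurable_toNat
    (hτ : IsStoppingTime (Filtration.piLE (X := fun _ : ℕ => Fin m)) τ) :
    Measurable fun x => (τ x).toNat := by
  have hm : ∀ n : ℕ, MeasurableSet {x | τ x = n} := fun n =>
    (Filtration.piLE (X := fun _ : ℕ => Fin m)).le n _ (measurableSet_eq_natCast hτ n)
  refine measurable_to_nat fun x => ?_
  -- `toNat` sends ⊤ to 0, so the level set at 0 also contains the paths that never stop.
  have : (fun x => (τ x).toNat) ⁻¹' {(τ x).toNat} =
      {y | τ y = ((τ x).toNat : ℕ)} ∪ ({y | (τ x).toNat = 0} ∩ {y | τ y < ⊤}ᶜ) := by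
    ext y
    simp only [Set.mem_preimage, Set.mem_singleton_iff, Set.mem_union, Set.mem_inter_iff,
      Set.mem_compl_iff, Set.mem_ofPred_eq, not_lt, top_le_iff]
    rcases eq_or_ne (τ y) ⊤ with h | h
    · simp [h, eq_comm]
    · constructor
      · intro h'
        left
        rw [← h', ENat.natCast_toNat h]
      · rintro (h' | h')
        · rw [h', ENat.toNat_natCast]
        · exact absurd h'.2 h
  rw [this]
  refine (hm _).union ((MeasurableSet.const _).inter (MeasurableSet.compl ?_))
  rw [setOf_lt_top_eq_iUnion]
  exact MeasurableSet.iUnion hm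

theorem measurable_stopped
    (hτ : IsStoppingTime (Filtration.piLE (X := fun _ : ℕ => Fin m)) τ)
    {u : ℕ → (ℕ → Fin m) → ℝ} (hu : ∀ n, Measurable (u n)) :
    Measurable fun x => u (τ x).toNat x := by
  have h : Measurable fun y : ℕ × (ℕ → Fin m) => u y.1 y.2 :=
    measurable_from_prod_countable_right fun n => hu n
  exact h.comp ((measurable_toNat hτ).prodMk measurable_id)

theorem lintegral_exp_neg_logLik_stopped_le {Q P : TransitionMatrix m} (hac : RowAC Q P)
    (μ : ProbVec m) (hτ : IsStoppingTime (Filtration.piLE (X := fun _ : ℕ => Fin m)) τ) :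
    ∫⁻ x in {x | τ x < ⊤}, ENNReal.ofReal (Real.exp (-logLik Q P (τ x).toNat x)) ∂(chainLaw Q μ) ≤
      chainLaw P μ {x | τ x < ⊤} := by
  have hm : ∀ n : ℕ, MeasurableSet {x | τ x = n} := fun n =>
    (Filtration.piLE (X := fun _ : ℕ => Fin m)).le n _ (measurableSet_eq_natCast hτ n)
  have hd : Pairwise (Function.onFun Disjoint fun n : ℕ => {x | τ x = n}) := by
    intro a b hab
    refine Set.disjoint_left.2 fun x hx hx' => hab ?_
    have h1 : τ x = a := hx
    have h2 : τ x = b := hx'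
    exact_mod_cast h1.symm.trans h2
  rw [setOf_lt_top_eq_iUnion, lintegral_iUnion hm hd, measure_iUnion hd hm]
  refine ENNReal.tsum_le_tsum fun n => ?_
  refine le_trans (le_of_eq ?_) (lintegral_exp_neg_logLik_le hac μ (measurableSet_eq_natCast hτ n))
  refine setLIntegral_congr_fun (hm n) fun x hx => ?_
  have h1 : τ x = n := hx
  simp only [h1, ENat.toNat_natCast]

/-- A uniform bound for a function of two states. -/
def absBound (g : Fin m → Fin m → ℝ) : ℝ := ∑ i, ∑ j, |g i j|

theorem abs_le_absBound (g : Fin m → Fin m → ℝ) (i j : Fin m) : |g i j| ≤ absBound g :=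
  (Finset.single_le_sum (f := fun j => |g i j|) (fun _ _ => abs_nonneg _)
    (Finset.mem_univ j)).trans
    (Finset.single_le_sum (f := fun i => ∑ j, |g i j|)
      (fun _ _ => Finset.sum_nonneg fun _ _ => abs_nonneg _) (Finset.mem_univ i))

theorem abs_sum_range_le (g : Fin m → Fin m → ℝ) (x : ℕ → Fin m) (n : ℕ) :
    |∑ t ∈ Finset.range n, g (x t) (x (t + 1))| ≤ absBound g * n := by
  refine (Finset.abs_sum_le_sum_abs _ _).trans ?_
  refine (Finset.sum_le_sum fun t _ => abs_le_absBound g (x t) (x (t + 1))).trans (le_of_eq ?_)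
  rw [Finset.sum_const, Finset.card_range, nsmul_eq_mul, mul_comm]

theorem measurable_transition (g : Fin m → Fin m → ℝ) (t : ℕ) :
    Measurable fun x : ℕ → Fin m => g (x t) (x (t + 1)) := by
  have h : Measurable fun y : Fin m × Fin m => g y.1 y.2 := Measurable.of_discrete
  have h' : Measurable fun x : ℕ → Fin m => (x t, x (t + 1)) := by fun_prop
  exact h.comp h'

theorem measurable_logLik (Q P : TransitionMatrix m) (n : ℕ) : Measurable (logLik Q P n) :=
  Finset.measurable_sum _ fun t _ =>
    measurable_transition (fun i j => Real.log (Q.1 i j / P.1 i j)) t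

/-- Optional stopping for the additive martingale with increments `g (X t, X (t + 1))`. -/
theorem integral_stopped_sum_eq_zero (Q : TransitionMatrix m) (μ : ProbVec m)
    (hτ : IsStoppingTime (Filtration.piLE (X := fun _ : ℕ => Fin m)) τ)
    (hfin : ∀ᵐ x ∂(chainLaw Q μ), τ x < ⊤)
    (hint : Integrable (fun x => ((τ x).toNat : ℝ)) (chainLaw Q μ))
    {g : Fin m → Fin m → ℝ} (hg : ∀ i, ∑ j, Q.1 i j * g i j = 0) :
    ∫ x, ∑ t ∈ Finset.range (τ x).toNat, g (x t) (x (t + 1)) ∂(chainLaw Q μ) = 0 := by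
  -- The sum stopped at min n τ, written with indicators of t < τ; each is known at time t, so every
  -- increment has mean zero.
  let F : ℕ → (ℕ → Fin m) → ℝ := fun n x =>
    ∑ t ∈ Finset.range n, ({x | τ x ≤ t}ᶜ : Set _).indicator (fun x => g (x t) (x (t + 1))) x
  have hmeas : ∀ t : ℕ, Measurable
      (({x | τ x ≤ t}ᶜ : Set _).indicator (fun x => g (x t) (x (t + 1)))) := fun t =>
    (measurable_transition g t).indicator
      ((Filtration.piLE (X := fun _ : ℕ => Fin m)).le t _ (measurableSet_piLE_lt hτ t))
  have hFm : ∀ n, Measurable (F n) := fun n => Finset.measurable_sum _ fun t _ => hmeas t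
  have hF : ∀ n x, τ x < ⊤ →
      F n x = ∑ t ∈ Finset.range (min n (τ x).toNat), g (x t) (x (t + 1)) := by
    intro n x hx
    have h1 : Finset.range (min n (τ x).toNat) =
        (Finset.range n).filter fun t : ℕ => t < (τ x).toNat := by
      ext t; simp
    rw [h1, Finset.sum_filter]
    refine Finset.sum_congr rfl fun t _ => ?_
    have h2 : x ∈ ({x | τ x ≤ t}ᶜ : Set _) ↔ t < (τ x).toNat := by
      rw [Set.mem_compl_iff, Set.mem_ofPred_eq, not_le]
      conv_lhs => rw [← ENat.natCast_toNat hx.ne]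
      exact Nat.cast_lt
    rw [Set.indicator_apply]
    exact if_congr h2 rfl rfl
  have hF0 : ∀ n, ∫ x, F n x ∂(chainLaw Q μ) = 0 := by
    intro n
    have hI : ∀ t ∈ Finset.range n, Integrable (({x | τ x ≤ t}ᶜ : Set _).indicator
        (fun x => g (x t) (x (t + 1)))) (chainLaw Q μ) := fun t _ =>
      Integrable.of_bound (hmeas t).aestronglyMeasurable (absBound g)
        (Filter.Eventually.of_forall fun x =>
          (norm_indicator_le_norm_self _ _).trans (abs_le_absBound g _ _))
    rw [integral_finsetSum _ hI]
    exact Finset.sum_eq_zero fun t _ =>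
      setIntegral_step_eq_zero Q μ (measurableSet_piLE_lt hτ t) hg
  -- Increments are bounded, so a constant multiple of the integrable τ dominates every truncated
  -- sum.
  have hlim := tendsto_integral_of_dominated_convergence (μ := chainLaw Q μ) (F := F)
    (f := fun x => ∑ t ∈ Finset.range (τ x).toNat, g (x t) (x (t + 1)))
    (fun x => absBound g * ((τ x).toNat : ℝ))
    (fun n => (hFm n).aestronglyMeasurable) (hint.const_mul _) ?_ ?_
  · simp only [hF0] at hlim
    exact (tendsto_nhds_unique hlim tendsto_const_nhds)
  · intro n
    filter_upwards [hfin] with x hx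
    rw [hF n x hx]
    refine (abs_sum_range_le g x _).trans (mul_le_mul_of_nonneg_left ?_
      (Finset.sum_nonneg fun _ _ => Finset.sum_nonneg fun _ _ => abs_nonneg _))
    exact_mod_cast min_le_right _ _
  · filter_upwards [hfin] with x hx
    refine tendsto_const_nhds.congr' ?_
    filter_upwards [Filter.eventually_ge_atTop (τ x).toNat] with n hn
    rw [hF n x hx, min_eq_right hn]

/-- The information inequality for a sequential test that rejects with probability at most `α`
under `P` and surely under `Q`. -/
theorem log_inv_le_integral_logLik {Q P : TransitionMatrix m} (hac : RowAC Q P)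
    (μ : ProbVec m) (hτ : IsStoppingTime (Filtration.piLE (X := fun _ : ℕ => Fin m)) τ)
    {α : ℝ} (hα : 0 < α) (hP : chainLaw P μ {x | τ x < ⊤} ≤ ENNReal.ofReal α)
    (hfin : ∀ᵐ x ∂(chainLaw Q μ), τ x < ⊤)
    (hint : Integrable (fun x => logLik Q P (τ x).toNat x) (chainLaw Q μ)) :
    Real.log (1 / α) ≤ ∫ x, logLik Q P (τ x).toNat x ∂(chainLaw Q μ) := by
  have hle := lintegral_exp_neg_logLik_stopped_le hac μ hτ
  rw [Measure.restrict_eq_self_of_ae_mem (s := {x | τ x < ⊤}) hfin] at hle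
  have hle' := hle.trans hP
  have hmeas : Measurable fun x => Real.exp (-logLik Q P (τ x).toNat x) :=
    (measurable_stopped hτ (measurable_logLik Q P)).neg.exp
  have hI : Integrable (fun x => Real.exp (-logLik Q P (τ x).toNat x)) (chainLaw Q μ) := by
    refine ⟨hmeas.aestronglyMeasurable, ?_⟩
    rw [hasFiniteIntegral_iff_ofReal (Filter.Eventually.of_forall fun _ => (Real.exp_pos _).le)]
    exact hle'.trans_lt ENNReal.ofReal_lt_top
  rw [← ofReal_integral_eq_lintegral_ofReal hI
    (Filter.Eventually.of_forall fun _ => (Real.exp_pos _).le),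
    ENNReal.ofReal_le_ofReal_iff hα.le] at hle'
  -- Jensen's inequality by a tangent line: log z ≤ z - 1 at z = exp(-L)/α, whose mean is at most 1.
  have hpt : ∀ x, -logLik Q P (τ x).toNat x - Real.log α ≤
      Real.exp (-logLik Q P (τ x).toNat x) / α - 1 := by
    intro x
    have := Real.log_le_sub_one_of_pos (div_pos (Real.exp_pos (-logLik Q P (τ x).toNat x)) hα)
    rwa [Real.log_div (Real.exp_pos _).ne' hα.ne', Real.log_exp] at this
  have hmono := integral_mono (μ := chainLaw Q μ) (hint.neg.sub (integrable_const (Real.log α)))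
    ((hI.div_const α).sub (integrable_const 1)) hpt
  have e1 := integral_sub hint.neg (integrable_const (μ := chainLaw Q μ) (Real.log α))
  have e2 := integral_sub (hI.div_const α) (integrable_const (μ := chainLaw Q μ) (1 : ℝ))
  simp only [Pi.sub_apply, Pi.neg_apply] at hmono e1
  rw [e1, e2, integral_neg, integral_div, integral_const, integral_const, probReal_univ, one_smul,
    one_smul] at hmono
  have h1 : (∫ x, Real.exp (-logLik Q P (τ x).toNat x) ∂(chainLaw Q μ)) / α ≤ 1 :=
    (div_le_one hα).2 hle'
  rw [one_div, Real.log_inv]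
  linarith

theorem integrable_toNat {Q : TransitionMatrix m} {μ : ProbVec m}
    (hτ : IsStoppingTime (Filtration.piLE (X := fun _ : ℕ => Fin m)) τ)
    (hfin : ∀ᵐ x ∂(chainLaw Q μ), τ x < ⊤) (hE : expectedTime Q μ τ ≠ ⊤) :
    Integrable (fun x => ((τ x).toNat : ℝ)) (chainLaw Q μ) ∧
      ∫ x, ((τ x).toNat : ℝ) ∂(chainLaw Q μ) = (expectedTime Q μ τ).toReal := by
  have hcongr : ∫⁻ x, ENNReal.ofReal ((τ x).toNat : ℝ) ∂(chainLaw Q μ) = expectedTime Q μ τ := by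
    refine lintegral_congr_ae ?_
    filter_upwards [hfin] with x hx
    conv_rhs => rw [← ENat.natCast_toNat hx.ne]
    simp
  have hmeas : Measurable fun x => ((τ x).toNat : ℝ) :=
    measurable_from_nat.comp (measurable_toNat hτ)
  have h0 : 0 ≤ᵐ[chainLaw Q μ] fun x => ((τ x).toNat : ℝ) :=
    Filter.Eventually.of_forall fun x => Nat.cast_nonneg _
  refine ⟨⟨hmeas.aestronglyMeasurable, ?_⟩, ?_⟩
  · rw [hasFiniteIntegral_iff_ofReal h0, hcongr]
    exact hE.lt_top
  · rw [integral_eq_lintegral_of_nonneg_ae h0 hmeas.aestronglyMeasurable, hcongr]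

theorem poissonCorrection_eq {Q : TransitionMatrix m} {μ : ProbVec m}
    (hfin : ∀ᵐ x ∂(chainLaw Q μ), τ x < ⊤) (ω : Fin m → ℝ) :
    poissonCorrection Q μ τ ω = ∫ x, (ω (x 0) - ω (x (τ x).toNat)) ∂(chainLaw Q μ) := by
  refine integral_congr_ae ?_
  filter_upwards [hfin] with x hx
  have h : stoppedValue (fun (n : ℕ) (y : ℕ → Fin m) => y n) τ x = x (τ x).toNat := by
    change x (τ x).untopA = _
    congr 1
    generalize τ x = s at hx
    lift s to ℕ using hx.ne
    rfl
  rw [h]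

theorem abs_poissonCorrection_le {Q : TransitionMatrix m} {μ : ProbVec m} {ω : Fin m → ℝ} {B : ℝ}
    (hω : ∀ i, |ω i| ≤ B) : |poissonCorrection Q μ τ ω| ≤ 2 * B := by
  have := norm_integral_le_of_norm_le_const (μ := chainLaw Q μ)
    (f := fun x => ω (x 0) - ω (stoppedValue (fun (n : ℕ) (y : ℕ → Fin m) => y n) τ x))
    (C := 2 * B) (Filter.Eventually.of_forall fun x => by
      rw [Real.norm_eq_abs, two_mul]
      exact (abs_sub _ _).trans (add_le_add (hω _) (hω _)))
  rwa [probReal_univ, mul_one] at this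

/-- The increments log(Q/P) - D - ω(X t) + ω(X (t+1)) have conditional mean zero exactly by the
Poisson equation, and the ω terms telescope; optional stopping then evaluates the mean
log-likelihood ratio. -/
theorem log_inv_le_of_poisson {Q P : TransitionMatrix m} (hac : RowAC Q P)
    (μ : ProbVec m) (hτ : IsStoppingTime (Filtration.piLE (X := fun _ : ℕ => Fin m)) τ)
    {α : ℝ} (hα : 0 < α) (hP : chainLaw P μ {x | τ x < ⊤} ≤ ENNReal.ofReal α)
    (hfin : ∀ᵐ x ∂(chainLaw Q μ), τ x < ⊤) (hE : expectedTime Q μ τ ≠ ⊤)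
    {D : ℝ} {ω : Fin m → ℝ}
    (hω : ∀ i, ω i - (Q.1.mulVec ω) i = rowKL Q P i - D) :
    Real.log (1 / α) ≤ D * (expectedTime Q μ τ).toReal + poissonCorrection Q μ τ ω := by
  obtain ⟨hN, hNE⟩ := integrable_toNat hτ hfin hE
  let ℓ : Fin m → Fin m → ℝ := fun i j => Real.log (Q.1 i j / P.1 i j)
  have hL : Integrable (fun x => logLik Q P (τ x).toNat x) (chainLaw Q μ) :=
    (hN.const_mul (absBound ℓ)).mono'
      (measurable_stopped hτ (measurable_logLik Q P)).aestronglyMeasurable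
      (Filter.Eventually.of_forall fun x => abs_sum_range_le ℓ x _)
  have hC : Integrable (fun x => ω (x 0) - ω (x (τ x).toNat)) (chainLaw Q μ) := by
    refine Integrable.of_bound (C := 2 * ∑ i, |ω i|) ?_ (Filter.Eventually.of_forall fun x => ?_)
    · refine Measurable.aestronglyMeasurable ?_
      refine measurable_stopped hτ (u := fun n x => ω (x 0) - ω (x n)) fun n => ?_
      exact (Measurable.of_discrete.comp (measurable_pi_apply 0)).sub
        (Measurable.of_discrete.comp (measurable_pi_apply n))
    · have h1 : ∀ i, |ω i| ≤ ∑ i, |ω i| := fun i =>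
        Finset.single_le_sum (f := fun i => |ω i|) (fun _ _ => abs_nonneg _) (Finset.mem_univ i)
      rw [Real.norm_eq_abs, two_mul]
      exact (abs_sub _ _).trans (add_le_add (h1 _) (h1 _))
  have hg : ∀ i, ∑ j, Q.1 i j * (ℓ i j - D - ω i + ω j) = 0 := by
    intro i
    have h1 : ∑ j, Q.1 i j = 1 := Matrix.sum_row_of_mem_rowStochastic Q.2 i
    have h2 : ∑ j, Q.1 i j * ℓ i j = rowKL Q P i := rfl
    have h3 : ∑ j, Q.1 i j * ω j = (Q.1.mulVec ω) i := rfl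
    simp only [mul_add, mul_sub, Finset.sum_add_distrib, Finset.sum_sub_distrib,
      ← Finset.sum_mul, h1, h2, h3]
    linarith [hω i]
  have h0 := integral_stopped_sum_eq_zero Q μ hτ hfin hN hg
  have hsum : ∀ x : ℕ → Fin m, ∑ t ∈ Finset.range (τ x).toNat,
      (ℓ (x t) (x (t + 1)) - D - ω (x t) + ω (x (t + 1))) =
      logLik Q P (τ x).toNat x - D * ((τ x).toNat : ℝ) - (ω (x 0) - ω (x (τ x).toNat)) := by
    intro x
    have h1 := Finset.sum_range_sub (fun t => ω (x t)) (τ x).toNat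
    have h2 : ∀ t, ℓ (x t) (x (t + 1)) - D - ω (x t) + ω (x (t + 1)) =
      ℓ (x t) (x (t + 1)) - D + (ω (x (t + 1)) - ω (x t)) := fun t => by ring
    simp only [h2]
    rw [Finset.sum_add_distrib, h1, Finset.sum_sub_distrib, Finset.sum_const, Finset.card_range,
      nsmul_eq_mul, logLik]
    ring
  simp only [hsum] at h0
  have h1 := integral_sub (hL.sub (hN.const_mul D)) hC
  simp only [Pi.sub_apply] at h1
  rw [h1, integral_sub hL (hN.const_mul D), integral_const_mul, hNE,
    ← poissonCorrection_eq hfin] at h0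
  have := log_inv_le_integral_logLik hac μ hτ hα hP hfin hL
  linarith

end Stopping

/-! ### Positivity of the divergence -/

/-- Adding q - p, which sums to zero over a row, turns the terms of the divergence, which may be
negative, into nonnegative ones. -/
theorem mul_log_div_eq_klFun {q p : ℝ} (hac : p = 0 → q = 0) :
    q * Real.log (q / p) = p * InformationTheory.klFun (q / p) + (q - p) := by
  rcases eq_or_ne p 0 with hp | hp
  · simp [hp, hac hp]
  · rw [InformationTheory.klFun_apply]
    field_simp
    ring

theorem rowKL_eq {m : ℕ} {Q P : TransitionMatrix m} (hac : RowAC Q P) (i : Fin m) :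
    rowKL Q P i = ∑ j, P.1 i j * InformationTheory.klFun (Q.1 i j / P.1 i j) := by
  have h1 : rowKL Q P i = ∑ j, Q.1 i j * Real.log (Q.1 i j / P.1 i j) := rfl
  rw [h1]
  simp only [fun j => mul_log_div_eq_klFun (hac i j), Finset.sum_add_distrib,
    Finset.sum_sub_distrib, Matrix.sum_row_of_mem_rowStochastic Q.2,
    Matrix.sum_row_of_mem_rowStochastic P.2, sub_self, add_zero]

theorem klFun_term_nonneg {m : ℕ} (Q P : TransitionMatrix m) (i j : Fin m) :
    0 ≤ P.1 i j * InformationTheory.klFun (Q.1 i j / P.1 i j) :=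
  mul_nonneg (P.2.1 i j) (InformationTheory.klFun_nonneg (div_nonneg (Q.2.1 i j) (P.2.1 i j)))

theorem rowKL_nonneg {m : ℕ} {Q P : TransitionMatrix m} (hac : RowAC Q P) (i : Fin m) :
    0 ≤ rowKL Q P i := by
  rw [rowKL_eq hac]
  exact Finset.sum_nonneg fun j _ => klFun_term_nonneg Q P i j

theorem row_eq_of_rowKL_eq_zero {m : ℕ} {Q P : TransitionMatrix m} (hac : RowAC Q P) {i : Fin m}
    (h : rowKL Q P i = 0) (j : Fin m) : Q.1 i j = P.1 i j := by
  rw [rowKL_eq hac, Finset.sum_eq_zero_iff_of_nonneg fun j _ => klFun_term_nonneg Q P i j] at h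
  rcases mul_eq_zero.1 (h j (Finset.mem_univ j)) with h0 | h0
  · rw [h0, hac i j h0]
  · rw [InformationTheory.klFun_eq_zero_iff (div_nonneg (Q.2.1 i j) (P.2.1 i j))] at h0
    exact eq_of_div_eq_one h0

/-- All summands π i f(i) of D are nonnegative, so each one is at most D. This is where 1/π_* enters
the second bound. -/
theorem rowKL_le_statKL_div {m : ℕ} [Nonempty (Fin m)] {Q P : TransitionMatrix m} {π : ProbVec m}
    (hac : RowAC Q P) (hp : ∀ i, 0 < π i) (i : Fin m) :
    rowKL Q P i ≤ statKL π Q P / minWeight π := by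
  rw [le_div_iff₀ (minWeight_pos hp), mul_comm]
  exact (mul_le_mul_of_nonneg_right (minWeight_le π i) (rowKL_nonneg hac i)).trans
    (Finset.single_le_sum (f := fun i => π i * rowKL Q P i)
      (fun i _ => mul_nonneg (hp i).le (rowKL_nonneg hac i)) (Finset.mem_univ i))

theorem statKL_pos {m : ℕ} {Q P : TransitionMatrix m} {π : ProbVec m}
    (hac : RowAC Q P) (hp : ∀ i, 0 < π i) (hne : Q ≠ P) : 0 < statKL π Q P := by
  have hnn : ∀ i ∈ Finset.univ, 0 ≤ π i * rowKL Q P i := fun i _ =>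
    mul_nonneg (hp i).le (rowKL_nonneg hac i)
  refine lt_of_le_of_ne (Finset.sum_nonneg hnn) fun h => hne ?_
  have h0 := (Finset.sum_eq_zero_iff_of_nonneg hnn).1 h.symm
  refine Subtype.ext (Matrix.ext fun i j => row_eq_of_rowKL_eq_zero hac ?_ j)
  exact (mul_eq_zero.1 (h0 i (Finset.mem_univ i))).resolve_left (hp i).ne'

/-- A common element of both hypotheses would give 1 ≤ α. -/
theorem IsTest.ne {m : ℕ} {H0 H1 : Set (TransitionMatrix m)} {α : ℝ} (hα1 : α < 1)
    {τ : (ℕ → Fin m) → ℕ∞} (hτ : IsTest H0 H1 α τ) (μ : ProbVec m) {Q P : TransitionMatrix m}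
    (hQ : Q ∈ H1) (hP : P ∈ H0) : Q ≠ P := by
  rintro rfl
  have h := hτ.alphaCorrect Q hP μ
  rw [hτ.powerOne Q hQ μ, ← ENNReal.ofReal_one] at h
  exact absurd h (not_le.2 (ENNReal.ofReal_lt_ofReal_iff one_pos |>.2 hα1))

theorem IsTest.ae_lt_top {m : ℕ} {H0 H1 : Set (TransitionMatrix m)} {α : ℝ}
    {τ : (ℕ → Fin m) → ℕ∞} (hτ : IsTest H0 H1 α τ) (μ : ProbVec m) {Q : TransitionMatrix m}
    (hQ : Q ∈ H1) : ∀ᵐ x ∂(chainLaw Q μ), τ x < ⊤ := by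
  have hm : MeasurableSet {x | τ x < ⊤} := by
    rw [setOf_lt_top_eq_iUnion]
    exact MeasurableSet.iUnion fun n => (Filtration.piLE (X := fun _ : ℕ => Fin m)).le n _
      (measurableSet_eq_natCast hτ.isStoppingTime n)
  exact (prob_compl_eq_zero_iff hm).2 (hτ.powerOne Q hQ μ)

/-! ### The lower bounds -/

/-- The bound with the Poisson correction, for a test with finite expected stopping time. -/
theorem log_inv_le_of_isTest {m : ℕ} [Nonempty (Fin m)] {H0 H1 : Set (TransitionMatrix m)} {α : ℝ}
    (hα0 : 0 < α) {Q : TransitionMatrix m} (hQ : Q ∈ H1) (hQerg : IsErgodic Q) {π : ProbVec m}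
    (hπ : IsStationary Q π) {τ : (ℕ → Fin m) → ℕ∞} (hτ : IsTest H0 H1 α τ) (μ : ProbVec m)
    {P : TransitionMatrix m} (hP : P ∈ H0) (hac : RowAC Q P) (hE : expectedTime Q μ τ ≠ ⊤) :
    Real.log (1 / α) ≤ statKL π Q P * (expectedTime Q μ τ).toReal +
      poissonCorrection Q μ τ (poissonSol Q π (rowKL Q P)) :=
  log_inv_le_of_poisson hac μ hτ.isStoppingTime hα0 (hτ.alphaCorrect P hP μ)
    (hτ.ae_lt_top μ hQ) hE fun i => poisson_equation hQerg hπ (rowKL Q P) i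

theorem abs_poissonCorrection_rowKL_le {m : ℕ} [Nonempty (Fin m)] {Q P : TransitionMatrix m}
    (hQerg : IsErgodic Q) {π : ProbVec m} (hπ : IsStationary Q π) (hac : RowAC Q P)
    (τ : (ℕ → Fin m) → ℕ∞) (μ : ProbVec m) (hD : 0 ≤ statKL π Q P) :
    |poissonCorrection Q μ τ (poissonSol Q π (rowKL Q P))| ≤
      2 * poissonConst Q π / minWeight π * statKL π Q P := by
  have hp := hπ.pos hQerg
  have hB := abs_poissonSol_le hQerg hπ (f := rowKL Q P) (B := statKL π Q P / minWeight π)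
    (div_nonneg hD (minWeight_pos hp).le) fun i => by
      rw [abs_of_nonneg (rowKL_nonneg hac i)]
      exact rowKL_le_statKL_div hac hp i
  refine (abs_poissonCorrection_le hB).trans (le_of_eq ?_)
  ring

/-- Because the correction is at most a multiple of D, log(1/α) ≤ T · D holds with the same T for
every P, so the infimum over P can be taken. -/
theorem ofReal_log_div_statKLInf_le {m : ℕ} [Nonempty (Fin m)] {H0 H1 : Set (TransitionMatrix m)}
    {α : ℝ} (hα0 : 0 < α) (hα1 : α < 1) {Q : TransitionMatrix m} (hQ : Q ∈ H1)
    (hQerg : IsErgodic Q) {π : ProbVec m} (hπ : IsStationary Q π) {τ : (ℕ → Fin m) → ℕ∞}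
    (hτ : IsTest H0 H1 α τ) (μ : ProbVec m) (hE : expectedTime Q μ τ ≠ ⊤) :
    ENNReal.ofReal (Real.log (1 / α)) / statKLInf π Q H0 ≤
      ENNReal.ofReal ((expectedTime Q μ τ).toReal + 2 * poissonConst Q π / minWeight π) := by
  have hlog : 0 < Real.log (1 / α) := Real.log_pos (by rw [lt_div_iff₀ hα0]; linarith)
  set T := (expectedTime Q μ τ).toReal + 2 * poissonConst Q π / minWeight π with hT
  have key : ∀ P ∈ H0, RowAC Q P → 0 < statKL π Q P ∧ Real.log (1 / α) ≤ T * statKL π Q P := by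
    intro P hP hac
    have hD := statKL_pos hac (hπ.pos hQerg) (hτ.ne hα1 μ hQ hP)
    refine ⟨hD, (log_inv_le_of_isTest hα0 hQ hQerg hπ hτ μ hP hac hE).trans ?_⟩
    have := (le_abs_self _).trans (abs_poissonCorrection_rowKL_le hQerg hπ hac τ μ hD.le)
    rw [hT, add_mul, mul_comm (statKL π Q P)]
    linarith
  by_cases hex : ∃ P ∈ H0, RowAC Q P
  · obtain ⟨P0, hP0, hac0⟩ := hex
    have hTpos : 0 < T := by
      obtain ⟨h1, h2⟩ := key P0 hP0 hac0
      by_contra! hneg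
      nlinarith
    refine ENNReal.div_le_of_le_mul' ?_
    -- Dividing by T > 0 isolates the infimum, so that the bound can be checked for each P
    -- separately.
    rw [← ENNReal.div_le_iff_le_mul (Or.inl (by simpa using hTpos))
      (Or.inl ENNReal.ofReal_ne_top)]
    refine le_iInf₂ fun P hP => le_iInf fun hac => ?_
    rw [ENNReal.div_le_iff_le_mul (Or.inl (by simpa using hTpos)) (Or.inl ENNReal.ofReal_ne_top),
      ← ENNReal.ofReal_mul (key P hP hac).1.le, mul_comm]
    exact ENNReal.ofReal_le_ofReal (key P hP hac).2
  -- With no P dominating Q the infimum is ⊤ and the left side is 0, so the sign of T is irrelevant.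
  · have : statKLInf π Q H0 = ⊤ := by
      rw [statKLInf]
      simp only [iInf_eq_top]
      exact fun P hP hac => absurd ⟨P, hP, hac⟩ hex
    rw [this, ENNReal.div_top]
    exact zero_le

end

end MarkovTest

/-! ### The two bounds in extended real form -/

theorem theorem1 {m : ℕ} (H0 H1 : Set (MarkovTest.TransitionMatrix m))
    (α : ℝ) (hα0 : 0 < α) (hα1 : α < 1)
    (Q : MarkovTest.TransitionMatrix m) (hQ : Q ∈ H1) (hQerg : MarkovTest.IsErgodic Q)
    (π : MarkovTest.ProbVec m) (hπ : MarkovTest.IsStationary Q π)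
    (τ : (ℕ → Fin m) → ℕ∞) (hτ : MarkovTest.IsTest H0 H1 α τ)
    (μ : MarkovTest.ProbVec m) :
    (∀ P ∈ H0, MarkovTest.RowAC Q P →
      0 < MarkovTest.statKL π Q P ∧
      ((Real.log (1 / α) / MarkovTest.statKL π Q P
          - MarkovTest.poissonCorrection Q μ τ
              (MarkovTest.poissonSol Q π (MarkovTest.rowKL Q P))
            / MarkovTest.statKL π Q P : ℝ) : EReal)
        ≤ ((MarkovTest.expectedTime Q μ τ : ℝ≥0∞) : EReal)) ∧
    max (((ENNReal.ofReal (Real.log (1 / α)) / MarkovTest.statKLInf π Q H0 : ℝ≥0∞) : EReal)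
          - ((2 * MarkovTest.poissonConst Q π / MarkovTest.minWeight π : ℝ) : EReal)) 0
      ≤ ((MarkovTest.expectedTime Q μ τ : ℝ≥0∞) : EReal) := by
  -- The case m = 0 is void: an empty vector cannot sum to 1.
  obtain ⟨i0⟩ : Nonempty (Fin m) := by
    by_contra h
    rw [not_nonempty_iff] at h
    have h1 : ∑ i, π i = 1 := π.2.2
    simp at h1
  have : Nonempty (Fin m) := ⟨i0⟩
  have hp := hπ.pos hQerg
  refine ⟨fun P hP hac => ?_, ?_⟩
  · have hD := MarkovTest.statKL_pos hac hp (hτ.ne hα1 μ hQ hP)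
    refine ⟨hD, ?_⟩
    rcases eq_or_ne (MarkovTest.expectedTime Q μ τ) ⊤ with hE | hE
    · rw [hE]
      exact le_top
    · have h := MarkovTest.log_inv_le_of_isTest hα0 hQ hQerg hπ hτ μ hP hac hE
      rw [← EReal.coe_toReal (x := ((MarkovTest.expectedTime Q μ τ : ℝ≥0∞) : EReal))
        (by simpa using hE) (by simp), EReal.toReal_coe_ennreal, EReal.coe_le_coe_iff, ← sub_div,
        div_le_iff₀ hD]
      linarith
  · refine max_le ?_ (EReal.coe_ennreal_nonneg _)
    rcases eq_or_ne (MarkovTest.expectedTime Q μ τ) ⊤ with hE | hE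
    · rw [hE]
      exact le_top
    · have h := MarkovTest.ofReal_log_div_statKLInf_le hα0 hα1 hQ hQerg hπ hτ μ hE
      have hC : 0 ≤ 2 * MarkovTest.poissonConst Q π / MarkovTest.minWeight π := by
        -- Nonnegativity of C_Q is read off from the bound |ω| ≤ C_Q for f = 1.
        have h1 := (abs_nonneg _).trans (MarkovTest.abs_poissonSol_le hQerg hπ (f := fun _ => 1)
          (B := 1) zero_le_one (fun _ => by simp) i0)
        rw [mul_one] at h1
        exact div_nonneg (mul_nonneg zero_le_two h1) (MarkovTest.minWeight_pos hp).le
      have h' := EReal.coe_ennreal_le_coe_ennreal_iff.2 h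
      rw [EReal.coe_ennreal_ofReal, max_eq_left (add_nonneg ENNReal.toReal_nonneg hC),
        EReal.coe_add] at h'
      refine EReal.sub_le_of_le_add (h'.trans (le_of_eq ?_))
      rw [← EReal.toReal_coe_ennreal, EReal.coe_toReal (by simpa using hE) (by simp)]
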